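/- Let $n\ge 1$, let $x=(x_1,\dots,x_n)$ and let $H=(H_1,\dots,H_n)\in\mathbb{C}[x]^n$ be a polynomial map whose components are homogeneous of one common degree. Assume that $x+H$ is a quasi-translation, i.e. that $x-H$ is the inverse of the polynomial map $x+H$. Let $\mathcal{J}H=(\partial H_i/\partial x_j)_{i,j}$ be the Jacobian matrix of $H$, and assume that its rank over $\mathbb{C}(x)$ satisfies $2\le \operatorname{rk}\mathcal{J}H\le (n+1)/2$. Write $V(H)=\{c\in\mathbb{C}^n : H(c)=0\}$, let $W\subseteq\mathbb{C}^n$ be the Zariski closure of the image of $H:\mathbb{C}^n\to\mathbb{C}^n$, and call a two-dimensional linear subspace of $\mathbb{C}^n$ that is contained in $V(H)$ a GN-plane of $H$. Say that linear subspaces intersect nontrivially if their intersection is not $\{0\}$. Then the following hold. (i) For each $p\in W$ and each $q\in W$, there are GN-planes $L_p\ni p$ and $L_q\ni q$ of $H$ which intersect nontrivially. (ii) If there exists a $p\in W$ which is contained in only finitely many GN-planes of $H$, then the set of such $p\in W$ is not contained in a proper algebraic subset of $W$. (iii) Suppose that $p^{(1)},\dots,p^{(k)}\in W$ are such that, for each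 $i$, $p^{(i)}$ is contained in only finitely many GN-planes of $H$. Then there exist GN-planes $L_{p^{(1)}}\ni p^{(1)},\dots,L_{p^{(k)}}\ni p^{(k)}$ of $H$ such that for each $q\in W$ there exists a GN-plane $L_q\ni q$ of $H$ which intersects $L_{p^{(i)}}$ nontrivially for each $i$. -/

import Mathlib

open MvPolynomial

noncomputable section

namespace GN

/-- Polynomial maps `ℂⁿ → ℂⁿ`, given by their coordinate polynomials. -/
abbrev PolyMap (n : ℕ) : Type := Fin n → MvPolynomial (Fin n) ℂ

/-- The identity polynomial map `x = (x₁, …, xₙ)`. -/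
def idMap (n : ℕ) : PolyMap n := fun i => X i

/-- The composition `G ∘ F`, i.e. `G(F(x))`. -/
def comp {n : ℕ} (G F : PolyMap n) : PolyMap n := fun i => bind₁ F (G i)

/-- `F` is a quasi-translation if `2x - F` is the (two-sided) inverse of `F`. -/
def IsQuasiTranslation {n : ℕ} (F : PolyMap n) : Prop :=
  comp (2 • idMap n - F) F = idMap n ∧ comp F (2 • idMap n - F) = idMap n

/-- All coordinates of `H` are homogeneous of one common degree. -/
def IsHomogeneousMap {n : ℕ} (H : PolyMap n) : Prop :=
  ∃ d : ℕ, ∀ i, (H i).IsHomogeneous d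

/-- The Jacobian matrix, with entries `∂Hᵢ/∂xⱼ`. -/
def jacobian {n : ℕ} (H : PolyMap n) : Matrix (Fin n) (Fin n) (MvPolynomial (Fin n) ℂ) :=
  Matrix.of fun i j => pderiv j (H i)

/-- The rank of the Jacobian matrix, over the field of rational functions `ℂ(x₁, …, xₙ)`. -/
def jacobianRank {n : ℕ} (H : PolyMap n) : ℕ :=
  ((jacobian H).map
    (algebraMap (MvPolynomial (Fin n) ℂ) (FractionRing (MvPolynomial (Fin n) ℂ)))).rank

/-- The function `ℂⁿ → ℂⁿ` defined by a polynomial map. -/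
def evalMap {n : ℕ} (H : PolyMap n) (c : Fin n → ℂ) : Fin n → ℂ := fun i => eval c (H i)

/-- The zero set `V(H)`. -/
def zeroSet {n : ℕ} (H : PolyMap n) : Set (Fin n → ℂ) := {c | evalMap H c = 0}

/-- Algebraic (Zariski closed) subsets of `ℂⁿ`. -/
def IsAlgebraicSet {n : ℕ} (S : Set (Fin n → ℂ)) : Prop :=
  ∃ I : Ideal (MvPolynomial (Fin n) ℂ), S = zeroLocus ℂ I

/-- The Zariski closure of a subset of `ℂⁿ`. -/
def zariskiClosure {n : ℕ} (S : Set (Fin n → ℂ)) : Set (Fin n → ℂ) :=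
  zeroLocus ℂ (vanishingIdeal ℂ S)

/-- The Zariski closure `W` of the image of `H`. -/
def imageClosure {n : ℕ} (H : PolyMap n) : Set (Fin n → ℂ) :=
  zariskiClosure (Set.range (evalMap H))

/-- A GN-plane of `H`: a two-dimensional linear subspace of `ℂⁿ` contained in `V(H)`. -/
def IsGNPlane {n : ℕ} (H : PolyMap n) (L : Submodule ℂ (Fin n → ℂ)) : Prop :=
  Module.finrank ℂ L = 2 ∧ (L : Set (Fin n → ℂ)) ⊆ zeroSet H

/-- `p` lies on only finitely many GN-planes of `H`. -/
def FinitelyManyGNPlanes {n : ℕ} (H : PolyMap n) (p : Fin n → ℂ) : Prop :=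
  {L : Submodule ℂ (Fin n → ℂ) | IsGNPlane H L ∧ p ∈ L}.Finite

end GN

end

/-! Write r for the Jacobian rank. A quasi-translation satisfies H(x + tH(x)) = H(x) for all t. Take
generic a, b with p = H(a), q = H(b) independent, and put v = a - b. Requiring H(y) to be
proportional to p and H(y - v) to q costs at most r - 1 equations each: it is enough to compare a
maximal algebraically independent set of components, which has at most r members
(`card_le_jacobianRank`, `exists_generic_proportional`). Since 2(r - 1) < n, Krull's height theorem
gives an irreducible, unbounded variety of solutions y through a (`exists_prime_unbounded`). On it H
is constant along y + ℂp and along y - v + ℂq (`sub_mem_translationCone`). Rescaling to the unit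
sphere and passing to a limit kills the shift v and gives c ≠ 0 with the same properties for both p
and q (`exists_common_direction`). Now H(c) is proportional to both p and q, hence zero, and H
vanishes on c + ℂp and c + ℂq. This yields planes in V(H) through p and q that meet in c.

All passages from generic to arbitrary points of W use elimination
(`exists_ne_zero_of_no_nontrivial_zero`): having a nonzero solution of homogeneous equations is a
closed condition on the parameters. This settles (i) once degenerate positions are treated. For
(ii), the planes through p correspond to points of a projective variety. It is finite exactly when
some hyperplane misses it, and this is an open condition on p.

For (iii), W is irreducible. If q lies on finitely many planes, then by (i) W is covered by the
finitely many sets of points on a plane meeting a given plane M through q. One of these sets is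
dense, hence all of W. Letting q vary over the dense set from (ii), each q has a plane meeting some
plane through every p⁽ⁱ⁾. There are finitely many tuples of planes through the p⁽ⁱ⁾, so one tuple
serves a dense set of q, hence all q. -/

namespace GN

/-! ### Elimination theory -/

/-- **Elimination**: solvability in projective space is a closed condition on the parameters. -/
theorem exists_ne_zero_of_no_nontrivial_zero {R k τ ι : Type*} [CommRing R] [Field k]
    [IsAlgClosed k] [Finite τ] (F : ι → MvPolynomial τ R) (d : ι → ℕ)
    (hF : ∀ j, (F j).IsHomogeneous (d j)) (φ₀ : R →+* k) (hφ₀ : Function.Surjective φ₀)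
    (h₀ : ∀ c : τ → k, (∀ j, eval c (map φ₀ (F j)) = 0) → c = 0) :
    ∃ s : R, φ₀ s ≠ 0 ∧ ∀ (φ : R →+* k) (c : τ → k), c ≠ 0 →
      (∀ j, eval c (map φ (F j)) = 0) → φ s = 0 := by
  classical
  set I : Ideal (MvPolynomial τ R) := Ideal.span (Set.range F) with hI
  set e : MvPolynomial τ R →+* MvPolynomial τ k := map φ₀ with he
  have hsurj : Function.Surjective e := map_surjective _ hφ₀
  let _ : GradedAlgebra (homogeneousSubmodule τ R) := gradedAlgebra
  have hIhom : I.IsHomogeneous (homogeneousSubmodule τ R) := by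
    refine Ideal.homogeneous_span _ _ ?_
    rintro _ ⟨j, rfl⟩
    exact ⟨d j, hF j⟩
  -- Nullstellensatz: with only the trivial zero, the specialised ideal contains every monomial of
  -- some degree M.
  have hrad : idealOfVars τ k ≤ (I.map e).radical := by
    rw [← vanishingIdeal_zeroLocus_eq_radical (K := k), idealOfVars, Ideal.span_le]
    rintro _ ⟨i, rfl⟩
    rw [SetLike.mem_coe, mem_vanishingIdeal_iff]
    intro c hc
    have : c = 0 := h₀ c fun j => by
      have := hc (e (F j)) (Ideal.mem_map_of_mem _ (Ideal.subset_span ⟨j, rfl⟩))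
      simpa [aeval_eq_eval] using this
    simp [this]
  obtain ⟨M, hM⟩ := Ideal.exists_pow_le_of_le_radical_of_fg hrad (idealOfVars_fg τ k)
  set V := homogeneousSubmodule τ R M
  set π := (I.restrictScalars R).mkQ
  set m : Ideal R := RingHom.ker φ₀
  have hV : V = Submodule.span R ((fun α => monomial α (1 : R)) '' {α | α.degree = M}) := by
    refine (homogeneousSubmodule_eq_finsupp_supported _ _ _).trans ?_
    exact AddMonoidAlgebra.supported_eq_span_single _ _
  -- Nakayama applied to the degree-M part of R[X]/I: lifting the monomials of degree M shows that
  -- it equals m times itself. So some s with s ≡ 1 modulo m puts s X_i ^ M in I, and s must vanish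
  -- wherever a nonzero solution exists.
  have hle : V.map π ≤ m • V.map π := by
    rw [← Submodule.map_smul'']
    conv_lhs => rw [hV]
    rw [Submodule.map_span, Submodule.span_le]
    rintro _ ⟨_, ⟨α, hα, rfl⟩, rfl⟩
    have hα' : α.degree = M := hα
    have h1 : monomial α (1 : k) ∈ I.map e :=
      hM ((monomial_mem_pow_idealOfVars_iff M α one_ne_zero).2 hα'.ge)
    obtain ⟨z, hz, hze⟩ := (Ideal.mem_map_iff_of_surjective e hsurj).1 h1
    have hzM : homogeneousComponent M z ∈ I := homogeneousComponent_mem_of_mem hIhom hz M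
    set y := monomial α (1 : R) - homogeneousComponent M z with hy
    have hyV : y ∈ V := by
      refine Submodule.sub_mem _ ?_ (homogeneousComponent_isHomogeneous M z)
      exact isHomogeneous_monomial _ hα'
    have hcoeff : ∀ β, coeff β y ∈ m := by
      intro β
      have hzc : ∀ β, φ₀ (coeff β z) = coeff β (monomial α (1 : k)) := fun β => by
        rw [← hze, he, coeff_map]
      change φ₀ (coeff β y) = 0
      rw [hy, coeff_sub, coeff_homogeneousComponent, map_sub]
      split_ifs with hβ
      · rw [hzc, coeff_monomial, coeff_monomial]
        split_ifs <;> simp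
      · have : α ≠ β := by rintro rfl; exact hβ hα'
        rw [coeff_monomial, if_neg this]
        simp
    have hmem : y ∈ m • V := by
      rw [y.as_sum]
      refine Submodule.sum_mem _ fun β hβ => ?_
      have : monomial β (coeff β y) = coeff β y • monomial β (1 : R) := by
        rw [smul_monomial, smul_eq_mul, mul_one]
      rw [this]
      refine Submodule.smul_mem_smul (hcoeff β) (isHomogeneous_monomial _ ?_)
      have hyV' : y.IsHomogeneous M := hyV
      by_contra hne
      exact (mem_support_iff.1 hβ) (hyV'.coeff_eq_zero hne)
    refine ⟨y, hmem, ?_⟩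
    rw [hy, map_sub, sub_eq_self]
    exact (Submodule.Quotient.mk_eq_zero _).2 hzM
  obtain ⟨s, hs, hsV⟩ := Submodule.exists_sub_one_mem_and_smul_eq_zero_of_fg_of_le_smul m
    (V.map π) ((homogeneousSubmodule_fg _ _ M).map π) hle
  have hs1 : φ₀ s = 1 := by
    have : φ₀ (s - 1) = 0 := hs
    rwa [map_sub, map_one, sub_eq_zero] at this
  refine ⟨s, by rw [hs1]; exact one_ne_zero, fun φ c hc hq => ?_⟩
  obtain ⟨i, hi⟩ := Function.ne_iff.1 hc
  have hX : (X i : MvPolynomial τ R) ^ M ∈ V := by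
    have := (isHomogeneous_X R i).pow M
    rwa [one_mul] at this
  have h2 : s • (X i : MvPolynomial τ R) ^ M ∈ I := by
    have := hsV _ ⟨_, hX, rfl⟩
    rw [← map_smul] at this
    exact (Submodule.Quotient.mk_eq_zero (I.restrictScalars R)).1 this
  have h3 : I ≤ RingHom.ker ((eval c).comp (map φ)) := by
    rw [hI, Ideal.span_le]
    rintro _ ⟨j, rfl⟩
    exact hq j
  have h4 : eval c (map φ (s • (X i : MvPolynomial τ R) ^ M)) = 0 := h3 h2
  rw [smul_eq_C_mul] at h4
  have hi' : c i ≠ 0 := hi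
  simpa [hi'] using h4

/-! ### Bounded and unbounded algebraic sets -/

/-- An element of an algebra of countable dimension over an uncountable field is algebraic if its
resolvent is defined at uncountably many scalars. -/
theorem isAlgebraic_of_not_countable_isUnit_sub {k A : Type} [Field k] [CommRing A] [Algebra k A]
    (hA : Module.rank k A ≤ Cardinal.aleph0) (x : A) (S : Set k) (hS : ¬ S.Countable)
    (hx : ∀ a ∈ S, IsUnit (x - algebraMap k A a)) : IsAlgebraic k x := by
  classical
  rcases subsingleton_or_nontrivial A with hA' | hA'
  · exact ⟨1, one_ne_zero, Subsingleton.elim _ _⟩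
  choose! u hu using hx
  -- Uncountably many resolvents cannot be independent. Clearing denominators in a relation gives
  -- the polynomial; at the node i only the i-th summand survives, so it is nonzero.
  have hdep : ¬ LinearIndependent k fun a : S => ((u a)⁻¹ : Aˣ).1 := by
    intro h
    exact hS (Cardinal.mk_le_aleph0_iff.1 (h.cardinal_le_rank.trans hA))
  rw [linearIndependent_iff'] at hdep
  push Not at hdep
  obtain ⟨t, g, hg, i, hi, hgi⟩ := hdep
  refine ⟨∑ a ∈ t, Polynomial.C (g a) * ∏ b ∈ t.erase a, (Polynomial.X - Polynomial.C (b : k)),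
    fun h0 => ?_, ?_⟩
  · have h1 := congrArg (Polynomial.eval (i : k)) h0
    rw [Polynomial.eval_finsetSum, Finset.sum_eq_single i, Polynomial.eval_mul,
      Polynomial.eval_prod] at h1
    · simp only [Polynomial.eval_C, Polynomial.eval_sub, Polynomial.eval_X, Polynomial.eval_zero,
        mul_eq_zero, hgi, false_or, Finset.prod_eq_zero_iff, sub_eq_zero] at h1
      obtain ⟨b, hb, hib⟩ := h1
      exact (Finset.mem_erase.1 hb).1 (Subtype.ext hib.symm)
    · intro b _ hb
      rw [Polynomial.eval_mul, Polynomial.eval_prod,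
        Finset.prod_eq_zero (Finset.mem_erase.2 ⟨hb.symm, hi⟩) (by simp), mul_zero]
    · exact fun h => (h hi).elim
  · have h1 : (∑ a ∈ t, g a • ((u a)⁻¹ : Aˣ).1) * ∏ b ∈ t, (x - algebraMap k A b) = 0 := by
      rw [hg, zero_mul]
    rw [← h1, map_sum, Finset.sum_mul]
    refine Finset.sum_congr rfl fun a ha => ?_
    rw [← Finset.mul_prod_erase _ _ ha, ← hu a a.2, map_mul, map_prod, Algebra.smul_def]
    simp only [Polynomial.aeval_C, map_sub, Polynomial.aeval_X]
    rw [mul_assoc, ← mul_assoc _ (u a).1, Units.inv_mul, one_mul]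

/-- A bounded algebraic subset of `ℂⁿ` is finite. -/
theorem finite_zeroLocus_of_bounded {n : ℕ} (I : Ideal (MvPolynomial (Fin n) ℂ)) (B : ℝ)
    (hB : ∀ y ∈ zeroLocus ℂ I, ‖y‖ ≤ B) : (zeroLocus ℂ I).Finite := by
  have halg : ∀ i, IsAlgebraic ℂ (Ideal.Quotient.mk I (X i)) := by
    intro i
    refine isAlgebraic_of_not_countable_isUnit_sub ?_ _ {a : ℂ | B < ‖a‖} ?_ ?_
    · refine (LinearMap.rank_le_of_surjective (Ideal.Quotient.mkₐ ℂ I).toLinearMap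
        (Ideal.Quotient.mkₐ_surjective ℂ I)).trans ?_
      rw [MvPolynomial.rank_eq]
      exact Cardinal.mk_le_aleph0
    · intro hc
      have h1 : (Set.Ioi (max B 0)).Countable := by
        refine Set.Countable.mono (fun t ht => ?_)
          (hc.preimage_of_injOn (f := fun t : ℝ => (t : ℂ)) Complex.ofReal_injective.injOn)
        have ht' : max B 0 < t := ht
        rw [max_lt_iff] at ht'
        simpa [abs_of_pos ht'.2] using ht'.1
      have h2 := Cardinal.mk_le_aleph0_iff.2 h1
      rw [Cardinal.mk_Ioi_real] at h2
      exact absurd Cardinal.aleph0_lt_continuum (not_lt.2 h2)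
    -- For |a| > B no zero has i-th coordinate a, so by the Nullstellensatz X i - a lies in no
    -- maximal ideal of the quotient.
    · intro a ha
      by_contra hu
      obtain ⟨m, hm, hmem⟩ := exists_max_ideal_of_mem_nonunits hu
      have hmax : (m.comap (Ideal.Quotient.mk I)).IsMaximal :=
        Ideal.comap_isMaximal_of_surjective _ Ideal.Quotient.mk_surjective
      obtain ⟨y, hy⟩ := isMaximal_iff_eq_vanishingIdeal_singleton.1 hmax
      have hyI : y ∈ zeroLocus ℂ I := by
        intro p hp
        have : p ∈ m.comap (Ideal.Quotient.mk I) := by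
          rw [Ideal.mem_comap, Ideal.Quotient.eq_zero_iff_mem.2 hp]
          exact m.zero_mem
        rw [hy] at this
        exact (mem_vanishingIdeal_singleton_iff _ _).1 this
      have h1 : X i - C a ∈ m.comap (Ideal.Quotient.mk I) := by
        rw [Ideal.mem_comap, map_sub]
        exact hmem
      rw [hy, mem_vanishingIdeal_singleton_iff] at h1
      have h2 : y i = a := by simpa [sub_eq_zero] using h1
      have h3 := (norm_le_pi_norm y i).trans (hB y hyI)
      rw [h2] at h3
      exact (not_le.2 ha) h3
  choose P hP0 hP using halg
  refine (Set.Finite.pi' fun i => (P i).roots.toFinset.finite_toSet).subset fun y hy i => ?_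
  simp only [Finset.mem_coe, Multiset.mem_toFinset]
  rw [Polynomial.mem_roots (hP0 i), Polynomial.IsRoot]
  have h1 : Polynomial.aeval (X i : MvPolynomial (Fin n) ℂ) (P i) ∈ I := by
    rw [← Ideal.Quotient.eq_zero_iff_mem, ← hP i]
    exact (Polynomial.aeval_algHom_apply (Ideal.Quotient.mkₐ ℂ I) (X i) (P i)).symm
  have h2 := hy _ h1
  rw [← Polynomial.aeval_algHom_apply] at h2
  simpa [Polynomial.aeval_def, Polynomial.eval₂_eq_eval_map] using h2

theorem exists_norm_gt_of_infinite_zeroLocus {n : ℕ} {I : Ideal (MvPolynomial (Fin n) ℂ)}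
    (hI : (zeroLocus ℂ I).Infinite) (B : ℝ) : ∃ y ∈ zeroLocus ℂ I, B < ‖y‖ := by
  by_contra! h
  exact hI (finite_zeroLocus_of_bounded I B h)

/-- The maximal ideal of a point of `ℂⁿ` has height at least `n`. -/
theorem le_height_vanishingIdeal_singleton {n : ℕ} (a : Fin n → ℂ) :
    (n : ℕ∞) ≤ (vanishingIdeal ℂ {a} : Ideal (MvPolynomial (Fin n) ℂ)).height := by
  set φ : ℕ → MvPolynomial (Fin n) ℂ →ₐ[ℂ] MvPolynomial (Fin n) ℂ := fun k =>
    aeval fun i => if (i : ℕ) < k then C (a i) else X i with hφ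
  have hprime : ∀ k, (RingHom.ker (φ k)).IsPrime := fun k => RingHom.ker_isPrime _
  -- Fixing the coordinates of `a` one at a time gives a strict chain of prime kernels.
  have key : ∀ k ≤ n, (k : ℕ∞) ≤ (RingHom.ker (φ k)).height := by
    intro k
    induction k with
    | zero => simp
    | succ k ih =>
      intro hk
      have hlt : RingHom.ker (φ k) < RingHom.ker (φ (k + 1)) := by
        have hcomp : ∀ p, φ (k + 1) (φ k p) = φ (k + 1) p := by
          intro p
          rw [← AlgHom.comp_apply]
          congr 1
          refine MvPolynomial.algHom_ext fun i => ?_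
          simp only [hφ, AlgHom.comp_apply, aeval_X]
          by_cases hi : (i : ℕ) < k
          · simp [hi, Nat.lt_succ_of_lt hi]
          · simp [hi]
        refine lt_of_le_of_ne (fun p hp => ?_) fun heq => ?_
        · rw [RingHom.mem_ker] at hp ⊢
          rw [← hcomp, hp, map_zero]
        · have h1 : X ⟨k, hk⟩ - C (a ⟨k, hk⟩) ∈ RingHom.ker (φ (k + 1)) := by
            simp [RingHom.mem_ker, hφ]
          rw [← heq, RingHom.mem_ker] at h1
          have h2 : (X ⟨k, hk⟩ : MvPolynomial (Fin n) ℂ) = C (a ⟨k, hk⟩) := by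
            simpa [hφ, sub_eq_zero] using h1
          have h3 := congrArg totalDegree h2
          simp at h3
      have := hprime k
      have := hprime (k + 1)
      calc ((k + 1 : ℕ) : ℕ∞) = k + 1 := by push_cast; rfl
        _ ≤ (RingHom.ker (φ k)).height + 1 := by gcongr; exact ih (by omega)
        _ ≤ _ := Ideal.height_add_one_le_of_lt_of_isPrime hlt
  refine (key n le_rfl).trans (Ideal.height_mono fun p hp => ?_)
  rw [mem_vanishingIdeal_singleton_iff]
  have h1 : φ n p = C (eval a p) := by
    rw [← aeval_eq_eval]
    have : φ n = (Algebra.ofId ℂ _).comp (aeval a) := by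
      refine MvPolynomial.algHom_ext fun i => ?_
      simp [hφ, Algebra.ofId_apply, MvPolynomial.algebraMap_eq]
    rw [this]; rfl
  rw [RingHom.mem_ker, h1] at hp
  simpa [aeval_eq_eval] using hp

/-- An irreducible component, through `a`, of the common zero set of fewer than `n` polynomials
in `n` variables is unbounded. -/
theorem exists_prime_unbounded {n : ℕ} (S : Finset (MvPolynomial (Fin n) ℂ)) (hS : S.card < n)
    (a : Fin n → ℂ) (ha : ∀ f ∈ S, eval a f = 0) :
    ∃ P : Ideal (MvPolynomial (Fin n) ℂ), P.IsPrime ∧ (∀ f ∈ S, f ∈ P) ∧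
      (∀ f ∈ P, eval a f = 0) ∧ ∀ B : ℝ, ∃ y ∈ zeroLocus ℂ P, B < ‖y‖ := by
  have hmax : (vanishingIdeal ℂ {a} : Ideal (MvPolynomial (Fin n) ℂ)).IsMaximal :=
    isMaximal_iff_eq_vanishingIdeal_singleton.2 ⟨a, rfl⟩
  have hle : Ideal.span (S : Set (MvPolynomial (Fin n) ℂ)) ≤ vanishingIdeal ℂ {a} := by
    rw [Ideal.span_le]
    intro f hf
    rw [SetLike.mem_coe, mem_vanishingIdeal_singleton_iff]
    simpa [aeval_eq_eval] using ha f hf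
  have := hmax.isPrime
  obtain ⟨P, hP, hPa⟩ := Ideal.exists_minimalPrimes_le hle
  have hPp : P.IsPrime := hP.1.1
  have hht : P.height ≤ S.card := Ideal.height_le_card_of_mem_minimalPrimes_span_finset hP
  refine ⟨P, hPp, fun f hf => hP.1.2 (Ideal.subset_span hf), fun f hf => ?_, ?_⟩
  · simpa [aeval_eq_eval] using (mem_vanishingIdeal_singleton_iff _ _).1 (hPa hf)
  refine exists_norm_gt_of_infinite_zeroLocus fun hfin => ?_
  have hPne : P ≠ vanishingIdeal ℂ {a} := by
    rintro rfl
    have := (le_height_vanishingIdeal_singleton a).trans hht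
    exact absurd (by exact_mod_cast this) (not_le.2 hS)
  apply hPne
  -- A prime with finite zero set contains an intersection of point ideals, hence one of them, and
  -- would be maximal; its height is too small for that.
  have h1 : (hfin.toFinset.inf fun y => vanishingIdeal ℂ {y}) ≤ P := by
    intro p hp
    rw [← IsPrime.vanishingIdeal_zeroLocus (K := ℂ) P, mem_vanishingIdeal_iff]
    intro y hy
    exact (mem_vanishingIdeal_singleton_iff _ _).1
      ((Finset.inf_le (f := fun y => vanishingIdeal ℂ {y}) (hfin.mem_toFinset.2 hy)) hp)
  obtain ⟨y, -, hy⟩ := (Ideal.IsPrime.inf_le' hPp).1 h1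
  have hymax : (vanishingIdeal ℂ {y} : Ideal (MvPolynomial (Fin n) ℂ)).IsMaximal :=
    isMaximal_iff_eq_vanishingIdeal_singleton.2 ⟨y, rfl⟩
  exact le_antisymm hPa ((hymax.eq_of_le hmax.ne_top (hy.trans hPa)).symm.le.trans hy)

/-! ### Algebraic independence and the Jacobian rank -/

theorem derivation_aeval_eq {k A M : Type*} [CommRing k] [CommRing A] [Algebra k A]
    [AddCommGroup M] [Module k M] [Module A M] (D : Derivation k A M)
    (S : Subalgebra k A) (hS : ∀ s ∈ S, D s = 0) (z : A) (P : Polynomial S) :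
    D (Polynomial.aeval z P) = Polynomial.aeval z P.derivative • D z := by
  induction P using Polynomial.induction_on' with
  | add p q hp hq => simp [hp, hq, add_smul]
  | monomial m a =>
    have ha : algebraMap S A a = (a : A) := rfl
    simp only [Polynomial.aeval_monomial, Polynomial.derivative_monomial, Derivation.leibniz,
      ha, hS a a.2, smul_zero, add_zero, Derivation.leibniz_pow, map_mul, map_natCast]
    simp only [mul_smul, Nat.cast_smul_eq_nsmul]

/-- In characteristic zero, a derivation vanishes on the elements that are algebraic over a
subalgebra on which it vanishes. -/
theorem derivation_eq_zero_of_isAlgebraic {k A M : Type*} [Field k] [CharZero k] [CommRing A]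
    [IsDomain A] [Algebra k A] [AddCommGroup M] [Module k M] [Module A M]
    [Module.IsTorsionFree A M] (D : Derivation k A M)
    (S : Subalgebra k A) (hS : ∀ s ∈ S, D s = 0) (z : A) (hz : IsAlgebraic S z) : D z = 0 := by
  obtain ⟨P, hP0, hP⟩ := hz
  induction hm : P.natDegree using Nat.strong_induction_on generalizing P with
  | _ m ih =>
  -- Either D z = 0, or the derivative of P is a relation of smaller degree, nonzero in
  -- characteristic zero.
  have h1 := derivation_aeval_eq D S hS z P
  rw [hP, map_zero, eq_comm, smul_eq_zero] at h1
  rcases h1 with h2 | h2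
  swap
  · exact h2
  have : CharZero S := charZero_of_injective_algebraMap (R := k) (algebraMap k S).injective
  have hpos : P.natDegree ≠ 0 := by
    intro h0
    rw [Polynomial.eq_C_of_natDegree_eq_zero h0, Polynomial.aeval_C] at hP
    apply hP0
    have h3 : P.coeff 0 = 0 := Subtype.val_injective hP
    rw [Polynomial.eq_C_of_natDegree_eq_zero h0, h3, map_zero]
  have hlt := Polynomial.natDegree_derivative_lt hpos
  exact ih _ (hm ▸ hlt) P.derivative
    (fun h => hpos (Polynomial.derivative_eq_zero.1 h)) h2 rfl

theorem mkDerivation_eq_sum {n : ℕ} {K : Type*} [Field K] [Algebra (MvPolynomial (Fin n) ℂ) K]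
    [Algebra ℂ K] [IsScalarTower ℂ (MvPolynomial (Fin n) ℂ) K]
    (δ : Fin n → K) (p : MvPolynomial (Fin n) ℂ) :
    mkDerivation ℂ δ p = ∑ k, algebraMap _ K (pderiv k p) * δ k := by
  induction p using MvPolynomial.induction_on with
  | C a => simp
  | add p q hp hq => simp [hp, hq, add_mul, Finset.sum_add_distrib]
  | mul_X p i hp =>
    simp only [Derivation.leibniz, hp, mkDerivation_X, pderiv_X, smul_eq_mul, map_add, map_mul,
      add_mul, Finset.sum_add_distrib, Algebra.smul_def]
    congr 1
    · rw [Finset.sum_eq_single i]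
      · simp
      · intro b _ hb; simp [hb.symm]
      · simp
    · rw [Finset.mul_sum]
      exact Finset.sum_congr rfl fun _ _ => by ring

/-- The number of algebraically independent components of `H` is at most the Jacobian rank. -/
theorem card_le_jacobianRank {n : ℕ} (H : PolyMap n) (s : Finset (Fin n))
    (hs : AlgebraicIndependent ℂ fun i : s => H i) : s.card ≤ jacobianRank H := by
  classical
  set A := MvPolynomial (Fin n) ℂ
  set K := FractionRing A
  obtain ⟨B, hsB, hB⟩ := exists_isTranscendenceBasis_superset hs.to_subtype_range
  have hcard := hB.cardinalMk_eq ((IsTranscendenceBasis.mvPolynomial (Fin n) ℂ).to_subtype_range)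
  have hXinj : Function.Injective (X : Fin n → A) := X_injective
  rw [Cardinal.mk_range_eq _ hXinj, Cardinal.mk_fin] at hcard
  have hfin : Finite B := Cardinal.lt_aleph0_iff_finite.1 (by
    rw [hcard]; exact Cardinal.natCast_lt_aleph0)
  have := Fintype.ofFinite B
  rw [Cardinal.mk_fintype, Nat.cast_inj] at hcard
  set Φ : (Fin n → K) →ₗ[K] (B → K) :=
    (Matrix.of fun (b : B) k => algebraMap A K (pderiv k b.1)).mulVecLin with hΦ
  have hΦD : ∀ δ b, Φ δ b = mkDerivation ℂ δ b.1 := fun δ b => by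
    exact (mkDerivation_eq_sum (K := K) δ b.1).symm
  -- A vector δ in the kernel defines a derivation vanishing on ℂ[B], hence on every X i, which is
  -- algebraic over it. As B has n elements, Φ is then also surjective, so the rows of the Jacobian
  -- indexed by `s` are independent.
  have hinj : Function.Injective Φ := by
    rw [injective_iff_map_eq_zero]
    intro δ hδ
    funext i
    have h1 : ∀ p ∈ Algebra.adjoin ℂ B, mkDerivation ℂ δ p = 0 := by
      intro p hp
      refine Derivation.eqOn_adjoin (D1 := mkDerivation ℂ δ) (D2 := 0) (fun b hb => ?_) hp
      rw [← hΦD δ ⟨b, hb⟩, hδ]; rfl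
    have h2 : IsAlgebraic (Algebra.adjoin ℂ B) (X i : A) := by
      have := hB.isAlgebraic
      rw [Subtype.range_coe] at this
      exact this.isAlgebraic _
    have h3 := derivation_eq_zero_of_isAlgebraic (mkDerivation ℂ δ) _ h1 _ h2
    rwa [mkDerivation_X] at h3
  have hsurj : Function.Surjective Φ :=
    (LinearMap.injective_iff_surjective_of_finrank_eq_finrank (by simp [hcard])).1 hinj
  set J := (jacobian H).map (algebraMap A K)
  set π : (Fin n → K) →ₗ[K] (s → K) := LinearMap.funLeft K K Subtype.val
  have htop : (LinearMap.range J.mulVecLin).map π = ⊤ := by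
    rw [eq_top_iff]
    intro w _
    set f : s → B := fun i => ⟨H i, hsB ⟨i, rfl⟩⟩ with hf
    have hfinj : Function.Injective f := fun i j hij => hs.injective (congrArg Subtype.val hij)
    obtain ⟨δ, hδ⟩ := hsurj (Function.extend f w 0)
    refine ⟨_, ⟨δ, rfl⟩, ?_⟩
    funext i
    have := congrFun hδ (f i)
    rw [hfinj.extend_apply] at this
    rw [← this]
    rfl
  have h1 : Module.finrank K ((LinearMap.range J.mulVecLin).map π) = s.card := by
    rw [htop, finrank_top]; simp
  rw [← h1]
  exact Submodule.finrank_map_le _ _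

/-! ### Homogeneous relations and proportionality at generic points -/

/-- Algebraically dependent forms of one degree satisfy a homogeneous relation. -/
theorem exists_homogeneous_relation {σ ι : Type*} {d : ℕ} (hd : 0 < d)
    (y : ι → MvPolynomial σ ℂ) (hy : ∀ i, (y i).IsHomogeneous d)
    (hdep : ¬ AlgebraicIndependent ℂ y) :
    ∃ (R : MvPolynomial ι ℂ) (e : ℕ), R ≠ 0 ∧ R.IsHomogeneous e ∧ aeval y R = 0 := by
  rw [algebraicIndependent_iff] at hdep
  push Not at hdep
  obtain ⟨R, hR, hR0⟩ := hdep
  obtain ⟨e, he⟩ : ∃ e, homogeneousComponent e R ≠ 0 := by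
    by_contra! h
    apply hR0
    rw [← sum_homogeneousComponent R]
    exact Finset.sum_eq_zero fun i _ => h i
  refine ⟨homogeneousComponent e R, e, he, homogeneousComponent_isHomogeneous e R, ?_⟩
  have h1 : ∀ i, (aeval y (homogeneousComponent i R)).IsHomogeneous (d * i) := fun i =>
    (homogeneousComponent_isHomogeneous i R).aeval y hy
  -- As d > 0, distinct components of R land in distinct degrees after substitution, so each is
  -- itself a relation.
  have h2 : homogeneousComponent (d * e) (aeval y R) = aeval y (homogeneousComponent e R) := by
    conv_lhs => rw [← sum_homogeneousComponent R]
    rw [map_sum, map_sum, Finset.sum_eq_single e]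
    · rw [homogeneousComponent_of_mem (h1 e), if_pos rfl]
    · intro i _ hi
      rw [homogeneousComponent_of_mem (h1 i), if_neg]
      exact fun h => hi (Nat.eq_of_mul_eq_mul_left hd h.symm)
    · intro h
      have : homogeneousComponent e R = 0 := homogeneousComponent_eq_zero _ _ (by
        simpa using h)
      simp [this]
  rw [← h2, hR, map_zero]

theorem aeval_mul_of_isHomogeneous {ι K : Type*} [Field K] [Algebra ℂ K] {R : MvPolynomial ι ℂ}
    {e : ℕ} (hR : R.IsHomogeneous e) (c : K) (y : ι → K) :
    aeval (fun i => c * y i) R = c ^ e * aeval y R := by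
  rw [aeval_def, aeval_def, eval₂_eq, eval₂_eq, Finset.mul_sum]
  refine Finset.sum_congr rfl fun α hα => ?_
  rw [hR.degree_eq_sum_deg_support hα, ← Finset.prod_pow_eq_pow_sum]
  simp only [mul_pow, Finset.prod_mul_distrib]
  ring

/-- At a generic point `a`, the values of all `H j` are determined up to scaling, over any
extension field, by those of a transcendence basis. -/
theorem exists_generic_proportional {n d : ℕ} (hd : 0 < d) (H : PolyMap n)
    (hH : ∀ i, (H i).IsHomogeneous d) (s : Finset (Fin n))
    (hs : AlgebraicIndependent ℂ fun i : s => H i)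
    (hmax : ∀ j, ¬ AlgebraicIndependent ℂ fun o : Option s => o.elim (H j) fun i => H i) :
    ∃ g : MvPolynomial (Fin n) ℂ, g ≠ 0 ∧ ∀ a, eval a g ≠ 0 →
      ∀ (K : Type) [Field K] [Algebra ℂ K] (ψ : MvPolynomial (Fin n) ℂ →ₐ[ℂ] K) (j₀ : Fin n),
        ψ (H j₀) ≠ 0 → eval a (H j₀) ≠ 0 →
        (∀ i ∈ s, ψ (H i) * algebraMap ℂ K (eval a (H j₀)) =
          ψ (H j₀) * algebraMap ℂ K (eval a (H i))) →
        ∀ j, ∃ c : ℂ, ψ (H j) = algebraMap ℂ K c * ψ (H j₀) := by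
  classical
  have hy : ∀ j, ∀ o : Option s, (o.elim (H j) fun i => H i).IsHomogeneous d := by
    rintro j (_ | i)
    exacts [hH j, hH i]
  choose R e hR0 hRe hR using fun j => exists_homogeneous_relation hd _ (hy j) (hmax j)
  have hcoef : ∀ j, ∃ m, (optionEquivLeft ℂ s (R j)).coeff m ≠ 0 := by
    intro j
    by_contra! h
    exact hR0 j ((map_eq_zero_iff _ (optionEquivLeft ℂ s).injective).1
      (Polynomial.ext (by simpa using h)))
  choose m hm using hcoef
  -- Where this product is nonzero, no relation R j collapses to zero when the basis components are
  -- specialised to their values at the point.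
  refine ⟨∏ j, aeval (fun i : s => H i) ((optionEquivLeft ℂ s (R j)).coeff (m j)), ?_, ?_⟩
  · refine Finset.prod_ne_zero_iff.2 fun j _ => ?_
    exact (map_ne_zero_iff _ hs).2 (hm j)
  intro a ha K _ _ ψ j₀ hψ hp hprop j
  rw [map_prod, Finset.prod_ne_zero_iff] at ha
  have haj := ha j (Finset.mem_univ _)
  set p : Fin n → ℂ := fun i => eval a (H i) with hpdef
  set Q : Polynomial ℂ := (optionEquivLeft ℂ s (R j)).map (eval fun i : s => p i) with hQ
  have hQ0 : Q ≠ 0 := by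
    intro h
    have h1 := congrArg (fun q => Polynomial.coeff q (m j)) h
    simp only [hQ, Polynomial.coeff_map, Polynomial.coeff_zero] at h1
    apply haj
    rw [← h1, ← aeval_eq_eval, ← aeval_eq_eval]
    change ((aeval a).comp (aeval fun i : s => H i)) _ = _
    congr 1
    exact MvPolynomial.algHom_ext fun i => by simp [hpdef, aeval_eq_eval]
  -- Rescaling ψ(H) so that the basis components become the constants H i (a) preserves the
  -- homogeneous relation. Thus w is a root of the complex polynomial Q, and so lies in ℂ.
  set w : K := ψ (H j) / ψ (H j₀) * algebraMap ℂ K (p j₀) with hw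
  have hroot : Polynomial.aeval w Q = 0 := by
    have h1 : Polynomial.aeval w Q =
        aeval (fun o : Option s => o.elim w fun i => algebraMap ℂ K (p i)) (R j) := by
      rw [hQ]
      generalize R j = r
      induction r using MvPolynomial.induction_on with
      | C c => simp
      | add p q hp hq => simp only [map_add, Polynomial.map_add, hp, hq]
      | mul_X q o hq =>
        rw [map_mul, Polynomial.map_mul, map_mul, hq, map_mul]
        congr 1
        rcases o with _ | i <;> simp
    rw [h1]
    have h2 : (fun o : Option s => o.elim w fun i => algebraMap ℂ K (p i)) = fun o =>
        (algebraMap ℂ K (p j₀) / ψ (H j₀)) * ψ (o.elim (H j) fun i => H i) := by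
      funext o
      rcases o with _ | i
      · simp only [Option.elim, hw]; ring
      · simp only [Option.elim]
        have := hprop i i.2
        field_simp
        linear_combination -this
    rw [h2, aeval_mul_of_isHomogeneous (hRe j)]
    have h3 : aeval (fun o : Option s => ψ (o.elim (H j) fun i => H i)) (R j) =
        ψ (aeval (fun o : Option s => o.elim (H j) fun i => H i) (R j)) := by
      rw [← AlgHom.comp_apply]
      congr 1
      exact MvPolynomial.algHom_ext fun i => by simp
    rw [h3, hR j, map_zero, mul_zero]
  obtain ⟨c, hc⟩ : ∃ c : ℂ, algebraMap ℂ K c = w := by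
    have h1 := (IsAlgClosed.splits Q).eq_prod_roots
    rw [h1, map_mul, Polynomial.aeval_C, mul_eq_zero, map_eq_zero,
      Polynomial.leadingCoeff_eq_zero, or_iff_right hQ0, map_multiset_prod,
      Multiset.prod_eq_zero_iff, Multiset.map_map, Multiset.mem_map] at hroot
    obtain ⟨c, -, hc⟩ := hroot
    exact ⟨c, (sub_eq_zero.1 (by simpa using hc)).symm⟩
  refine ⟨c / p j₀, ?_⟩
  have hp' : algebraMap ℂ K (p j₀) ≠ 0 := (map_ne_zero _).2 hp
  rw [map_div₀, hc, hw]
  field_simp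

/-! ### Quasi-translations and low Jacobian rank -/

theorem continuous_evalMap {n : ℕ} (H : PolyMap n) : Continuous (evalMap H) :=
  continuous_pi fun i => MvPolynomial.continuous_eval (H i)

theorem eval_aeval {n m : ℕ} (y : Fin n → ℂ) (G : Fin m → MvPolynomial (Fin n) ℂ)
    (p : MvPolynomial (Fin m) ℂ) : eval y (aeval G p) = eval (fun i => eval y (G i)) p := by
  rw [← aeval_eq_eval, ← aeval_eq_eval, ← AlgHom.comp_apply]
  congr 1
  exact MvPolynomial.algHom_ext fun i => by simp [aeval_eq_eval]

theorem evalMap_smul {n d : ℕ} {H : PolyMap n} (hH : ∀ i, (H i).IsHomogeneous d) (t : ℂ)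
    (c : Fin n → ℂ) : evalMap H (t • c) = t ^ d • evalMap H c := by
  funext i
  have := aeval_mul_of_isHomogeneous (hH i) t c
  rw [aeval_eq_eval] at this
  exact this

/-- A quasi-translation `x + H` satisfies `H (x + t H) = H`. -/
theorem evalMap_add_smul_evalMap {n : ℕ} {H : PolyMap n}
    (hqt : IsQuasiTranslation (idMap n + H)) (x : Fin n → ℂ) (t : ℂ) :
    evalMap H (x + t • evalMap H x) = evalMap H x := by
  have h1 : ∀ x, evalMap H (x + evalMap H x) = evalMap H x := by
    intro x
    funext i
    have h := congrArg (eval x) (congrFun hqt.1 i)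
    have hF : (fun j => eval x ((idMap n + H) j)) = x + evalMap H x := by
      funext j
      simp [idMap, evalMap]
    rw [comp, bind₁, eval_aeval, hF] at h
    simp only [two_smul, idMap, Pi.sub_apply, Pi.add_apply, map_sub, map_add, eval_X] at h
    simp only [evalMap] at h ⊢
    linear_combination -h
  -- Iteration gives all natural t; the identity is polynomial in t, so it extends to ℂ.
  have h2 : ∀ k : ℕ, evalMap H (x + (k : ℂ) • evalMap H x) = evalMap H x := by
    intro k
    induction k with
    | zero => simp
    | succ k ih =>
      have := h1 (x + (k : ℂ) • evalMap H x)
      rw [ih] at this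
      have e : x + ((k + 1 : ℕ) : ℂ) • evalMap H x =
          x + (k : ℂ) • evalMap H x + evalMap H x := by push_cast; module
      rw [e, this]
  funext i
  set P : Polynomial ℂ := aeval (fun j => Polynomial.C (x j) +
    Polynomial.X * Polynomial.C (evalMap H x j)) (H i) - Polynomial.C (evalMap H x i) with hP
  have hPe : ∀ t, P.eval t = evalMap H (x + t • evalMap H x) i - evalMap H x i := by
    intro t
    rw [hP, Polynomial.eval_sub, Polynomial.eval_C]
    congr 1
    rw [evalMap, ← aeval_eq_eval]
    change (((Polynomial.aeval t).comp (aeval _)) (H i) : ℂ) = _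
    congr 1
    exact MvPolynomial.algHom_ext fun i => by simp; ring
  have hP0 : P = 0 := by
    refine Polynomial.eq_zero_of_infinite_isRoot P
      ((Set.infinite_range_of_injective (Nat.cast_injective (R := ℂ))).mono ?_)
    rintro _ ⟨k, rfl⟩
    change P.eval (k : ℂ) = 0
    rw [hPe, h2, sub_self]
  have := hPe t
  rw [hP0, Polynomial.eval_zero] at this
  exact (sub_eq_zero.1 this.symm)

theorem degree_pos_of_jacobianRank {n d : ℕ} {H : PolyMap n} (hH : ∀ i, (H i).IsHomogeneous d)
    (hr : 1 ≤ jacobianRank H) : 0 < d := by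
  rw [Nat.pos_iff_ne_zero]
  rintro rfl
  have : jacobian H = 0 := by
    ext1 i j
    have h1 := totalDegree_eq_zero_iff_eq_C.1 ((totalDegree_zero_iff_isHomogeneous _).2 (hH i))
    simp only [jacobian, Matrix.of_apply, Matrix.zero_apply]
    rw [h1, pderiv_C]
  rw [jacobianRank, this, Matrix.map_zero _ (map_zero _), Matrix.rank_zero] at hr
  omega

theorem exists_component_ne_zero {n : ℕ} {H : PolyMap n} (hr : 1 ≤ jacobianRank H) :
    ∃ j, H j ≠ 0 := by
  by_contra! h
  have : jacobian H = 0 := by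
    ext1 i j
    simp [jacobian, h]
  rw [jacobianRank, this, Matrix.map_zero _ (map_zero _), Matrix.rank_zero] at hr
  omega

/-- If the Jacobian rank is at least two, then the image of `H` is not contained in a line. -/
theorem exists_minor_ne_zero {n : ℕ} {H : PolyMap n} (hr : 2 ≤ jacobianRank H) {v : Fin n → ℂ}
    {i : Fin n} (hv : v i ≠ 0) : ∃ j, C (v i) * H j - C (v j) * H i ≠ 0 := by
  by_contra! h
  set K := FractionRing (MvPolynomial (Fin n) ℂ)
  have h1 : (jacobian H).map (algebraMap _ K) =
      Matrix.vecMulVec (fun j => algebraMap (MvPolynomial (Fin n) ℂ) K (C (v j / v i)))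
        (fun k => algebraMap (MvPolynomial (Fin n) ℂ) K (pderiv k (H i))) := by
    ext j k
    rw [Matrix.map_apply, Matrix.vecMulVec_apply, ← map_mul]
    congr 1
    have h2 : H j = C (v j / v i) * H i := by
      have h3 : C (v i)⁻¹ * (C (v i) * H j - C (v j) * H i) = 0 := by rw [h j, mul_zero]
      rw [mul_sub, ← mul_assoc, ← mul_assoc, ← C_mul, ← C_mul, inv_mul_cancel₀ hv, C_1, one_mul,
        sub_eq_zero] at h3
      rw [h3, div_eq_inv_mul]
    simp only [jacobian, Matrix.of_apply]
    conv_lhs => rw [h2, pderiv_C_mul]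
  rw [jacobianRank, h1] at hr
  have := Matrix.rank_vecMulVec_le (fun j => algebraMap (MvPolynomial (Fin n) ℂ) K (C (v j / v i)))
        (fun k => algebraMap (MvPolynomial (Fin n) ℂ) K (pderiv k (H i)))
  omega

/-! ### Translation cones and directions at infinity -/

/-- The points `z` for which `H z` is proportional to `p` and `H` is constant on `z + ℂ p`. -/
def translationCone {n : ℕ} (H : PolyMap n) (p : Fin n → ℂ) (j₀ : Fin n) : Set (Fin n → ℂ) :=
  {z | (∀ j, p j₀ * evalMap H z j = p j * evalMap H z j₀) ∧
    ∀ t : ℂ, evalMap H (z + t • p) = evalMap H z}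

theorem isClosed_translationCone {n : ℕ} (H : PolyMap n) (p : Fin n → ℂ) (j₀ : Fin n) :
    IsClosed (translationCone H p j₀) := by
  have hc := continuous_evalMap H
  have hcj : ∀ j, Continuous fun z => evalMap H z j := fun j => (continuous_apply j).comp hc
  refine IsClosed.and ?_ ?_
  · simp only [Set.ofPred_forall]
    exact isClosed_iInter fun j => isClosed_eq ((hcj j).const_mul _) ((hcj j₀).const_mul _)
  · simp only [Set.ofPred_forall]
    exact isClosed_iInter fun t => isClosed_eq (hc.comp (by fun_prop)) hc

theorem smul_mem_translationCone {n d : ℕ} {H : PolyMap n} (hH : ∀ i, (H i).IsHomogeneous d)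
    {p : Fin n → ℂ} {j₀ : Fin n} {z : Fin n → ℂ} (hz : z ∈ translationCone H p j₀) {e : ℂ}
    (he : e ≠ 0) : e • z ∈ translationCone H p j₀ := by
  refine ⟨fun j => ?_, fun t => ?_⟩
  · have := hz.1 j
    simp only [evalMap_smul hH, Pi.smul_apply, smul_eq_mul]
    linear_combination e ^ d * this
  · have : e • z + t • p = e • (z + (t / e) • p) := by
      rw [smul_add, smul_smul, mul_div_cancel₀ _ he]
    rw [this, evalMap_smul hH, evalMap_smul hH, hz.2]

/-- Directions at infinity of an unbounded subset, with translates in given cones. -/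
theorem exists_common_direction {n : ℕ} {Y T₁ T₂ : Set (Fin n → ℂ)} (v : Fin n → ℂ)
    (hY : ∀ B : ℝ, ∃ y ∈ Y, B < ‖y‖) (h₁ : IsClosed T₁) (h₂ : IsClosed T₂)
    (hs₁ : ∀ z ∈ T₁, ∀ e : ℂ, e ≠ 0 → e • z ∈ T₁) (hs₂ : ∀ z ∈ T₂, ∀ e : ℂ, e ≠ 0 → e • z ∈ T₂)
    (hY₁ : Y ⊆ T₁) (hY₂ : ∀ y ∈ Y, y - v ∈ T₂) : ∃ c ≠ 0, c ∈ T₁ ∧ c ∈ T₂ := by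
  choose y hy hyn using fun m : ℕ => hY m
  have hpos : ∀ m, 0 < ‖y m‖ := fun m => (Nat.cast_nonneg m).trans_lt (hyn m)
  set e : ℕ → ℂ := fun m => ((‖y m‖⁻¹ : ℝ) : ℂ) with he
  have he0 : ∀ m, e m ≠ 0 := fun m => by simpa [he] using (hpos m).ne'
  have hsph : ∀ m, e m • y m ∈ Metric.sphere (0 : Fin n → ℂ) 1 := fun m => by
    simp [he, norm_smul, (hpos m).ne']
  obtain ⟨c, hc, φ, hφ, hlim⟩ := (isCompact_sphere (0 : Fin n → ℂ) 1).tendsto_subseq hsph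
  have hnorm : ‖c‖ = 1 := by simpa using hc
  have hlim0 : Filter.Tendsto (fun m => e (φ m)) Filter.atTop (nhds 0) := by
    have h1 : Filter.Tendsto (fun m => ‖y m‖) Filter.atTop Filter.atTop :=
      Filter.tendsto_atTop_mono (fun m => (hyn m).le) tendsto_natCast_atTop_atTop
    have h2 := (Complex.continuous_ofReal.tendsto 0).comp (tendsto_inv_atTop_zero.comp h1)
    simpa [he, Function.comp_def] using h2.comp hφ.tendsto_atTop
  refine ⟨c, fun h => by simp [h] at hnorm, ?_, ?_⟩
  · exact h₁.mem_of_tendsto hlim (Filter.Eventually.of_forall fun m =>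
      hs₁ _ (hY₁ (hy _)) _ (he0 _))
  -- The scaling factors tend to zero, so the shift by v disappears in the limit.
  · have h3 : Filter.Tendsto (fun m => e (φ m) • (y (φ m) - v)) Filter.atTop (nhds c) := by
      have := hlim.sub (hlim0.smul_const v)
      simpa [smul_sub] using this
    exact h₂.mem_of_tendsto h3 (Filter.Eventually.of_forall fun m =>
      hs₂ _ (hY₂ _ (hy _)) _ (he0 _))

/-- An irreducible variety along which a transcendence basis of the components of `H` stays
proportional to its value at a generic point lies in the translation cone of that value. -/
theorem sub_mem_translationCone {n : ℕ} {H : PolyMap n}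
    (hqt : IsQuasiTranslation (idMap n + H)) {g : MvPolynomial (Fin n) ℂ} {s : Finset (Fin n)}
    (hg : ∀ a, eval a g ≠ 0 →
      ∀ (K : Type) [Field K] [Algebra ℂ K] (ψ : MvPolynomial (Fin n) ℂ →ₐ[ℂ] K) (j₀ : Fin n),
        ψ (H j₀) ≠ 0 → eval a (H j₀) ≠ 0 →
        (∀ i ∈ s, ψ (H i) * algebraMap ℂ K (eval a (H j₀)) =
          ψ (H j₀) * algebraMap ℂ K (eval a (H i))) →
        ∀ j, ∃ c : ℂ, ψ (H j) = algebraMap ℂ K c * ψ (H j₀))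
    (P : Ideal (MvPolynomial (Fin n) ℂ)) (hP : P.IsPrime) (a v : Fin n → ℂ)
    (haP : ∀ f ∈ P, eval a f = 0) (hga : eval (a - v) g ≠ 0) (j₀ : Fin n)
    (hj₀ : eval (a - v) (H j₀) ≠ 0)
    (hs : ∀ i ∈ s, aeval (fun k => X k - C (v k))
      (H i * C (eval (a - v) (H j₀)) - H j₀ * C (eval (a - v) (H i))) ∈ P)
    (y : Fin n → ℂ) (hy : y ∈ zeroLocus ℂ P) :
    y - v ∈ translationCone H (evalMap H (a - v)) j₀ := by
  set p := evalMap H (a - v) with hp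
  set τ : MvPolynomial (Fin n) ℂ →ₐ[ℂ] MvPolynomial (Fin n) ℂ :=
    aeval (fun k => X k - C (v k)) with hτ
  have hτe : ∀ y f, eval y (τ f) = eval (y - v) f := fun y f => by
    rw [hτ, eval_aeval]
    congr 2
    funext i
    simp
  have hyP : ∀ y ∈ zeroLocus ℂ P, ∀ f ∈ P, eval y f = 0 := fun y hy f hf => by
    simpa [aeval_eq_eval] using hy f hf
  have hH0 : τ (H j₀) ∉ P := fun h => hj₀ (by rw [← hτe]; exact haP _ h)
  -- Proportionality is applied over the function field of the variety. The resulting ratios are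
  -- complex constants, hence are determined by evaluation at `a`.
  set K := FractionRing (MvPolynomial (Fin n) ℂ ⧸ P)
  set ι : MvPolynomial (Fin n) ℂ →ₐ[ℂ] K :=
    (IsScalarTower.toAlgHom ℂ (MvPolynomial (Fin n) ℂ ⧸ P) K).comp (Ideal.Quotient.mkₐ ℂ P)
  have hι : ∀ f, ι f = 0 ↔ f ∈ P := fun f => by
    rw [← Ideal.Quotient.eq_zero_iff_mem]
    exact map_eq_zero_iff _ (IsFractionRing.injective (MvPolynomial (Fin n) ℂ ⧸ P) K)
  have h1 := hg (a - v) hga K (ι.comp τ) j₀ (fun h => hH0 ((hι _).1 h)) hj₀ (by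
    intro i hi
    have h2 := (hι _).2 (hs i hi)
    rw [map_sub, map_sub, map_mul, map_mul, map_mul, map_mul, sub_eq_zero] at h2
    have hC : ∀ z : ℂ, ι (τ (C z)) = algebraMap ℂ K z := fun z => by
      rw [← MvPolynomial.algebraMap_eq, AlgHom.commutes, AlgHom.commutes]
    rw [hC, hC] at h2
    exact h2)
  have h2 : ∀ y ∈ zeroLocus ℂ P, ∀ j,
      p j₀ * evalMap H (y - v) j = p j * evalMap H (y - v) j₀ := by
    intro y hy j
    obtain ⟨c, hc⟩ := h1 j
    have h3 : τ (H j) - C c * τ (H j₀) ∈ P := by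
      rw [← hι, map_sub, map_mul, ← MvPolynomial.algebraMap_eq, AlgHom.commutes, sub_eq_zero]
      exact hc
    have h4 := haP _ h3
    have h5 := hyP y hy _ h3
    simp only [map_sub, map_mul, eval_C, hτe] at h4 h5
    have h4' : p j - c * p j₀ = 0 := h4
    have h5' : evalMap H (y - v) j - c * evalMap H (y - v) j₀ = 0 := h5
    linear_combination p j₀ * h5' - evalMap H (y - v) j₀ * h4'
  refine ⟨h2 y hy, fun t => ?_⟩
  funext j
  set F := aeval (fun k => X k - C (v k) + C (t * p k)) (H j) - τ (H j) with hF
  have hFe : ∀ y, eval y F = evalMap H (y - v + t • p) j - evalMap H (y - v) j := by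
    intro y
    rw [hF, map_sub, hτe, eval_aeval]
    congr 2
    congr 1
    funext k
    simp
  -- Where H j₀ (y - v) is nonzero, p is a multiple of H(y - v) and the quasi-translation identity
  -- gives F = 0. The factor τ (H j₀) covers the other points, and is cancelled because P is prime.
  have hmem : τ (H j₀) * F ∈ P := by
    rw [← IsPrime.vanishingIdeal_zeroLocus (K := ℂ) P, mem_vanishingIdeal_iff]
    intro y hy
    rw [aeval_eq_eval]
    change eval y _ = 0
    rw [map_mul, hτe, hFe, mul_eq_zero]
    by_cases h0 : evalMap H (y - v) j₀ = 0
    · exact Or.inl h0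
    right
    have hpj : p j₀ ≠ 0 := hj₀
    have h6 : t • p = (t * p j₀ / evalMap H (y - v) j₀) • evalMap H (y - v) := by
      funext j
      have := h2 y hy j
      simp only [Pi.smul_apply, smul_eq_mul]
      field_simp
      linear_combination (-t) * this
    rw [h6, evalMap_add_smul_evalMap hqt, sub_self]
  have := hyP y hy F ((hP.mem_or_mem hmem).resolve_left hH0)
  rw [hFe, sub_eq_zero] at this
  exact this

/-- `H` vanishes on the line `p + ℂ c`. -/
def VanishesAlong {n : ℕ} (H : PolyMap n) (p c : Fin n → ℂ) : Prop :=
  ∀ t : ℂ, evalMap H (p + t • c) = 0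

/-- For t ≠ 0, p + tc = t(c + t⁻¹p), so homogeneity exchanges the roles of p and c; t = 0 follows by
continuity. -/
theorem vanishesAlong_of_add_smul {n d : ℕ} {H : PolyMap n} (hH : ∀ i, (H i).IsHomogeneous d)
    {p c : Fin n → ℂ} (h : ∀ t : ℂ, evalMap H (c + t • p) = 0) : VanishesAlong H p c := by
  have hclosed : IsClosed {t : ℂ | evalMap H (p + t • c) = 0} :=
    isClosed_eq ((continuous_evalMap H).comp (by fun_prop)) continuous_const
  have hsub : ({0}ᶜ : Set ℂ) ⊆ {t : ℂ | evalMap H (p + t • c) = 0} := by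
    intro t ht
    have ht' : t ≠ 0 := ht
    have : p + t • c = t • (c + t⁻¹ • p) := by
      rw [smul_add, smul_smul, mul_inv_cancel₀ ht', one_smul, add_comm]
    change evalMap H _ = 0
    rw [this, evalMap_smul hH, h, smul_zero]
  intro t
  exact hclosed.closure_subset_iff.2 hsub ((dense_compl_singleton (0 : ℂ)) t)

/-- Two generic points of the image of `H` see a common nonzero point along which `H` vanishes. -/
theorem exists_generic_common_point {n d : ℕ} {H : PolyMap n}
    (hH : ∀ i, (H i).IsHomogeneous d) (hqt : IsQuasiTranslation (idMap n + H))
    (hr : 2 ≤ jacobianRank H) (hr' : 2 * jacobianRank H ≤ n + 1) :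
    ∃ g : MvPolynomial (Fin n) ℂ, g ≠ 0 ∧ ∀ a b, eval a g ≠ 0 → eval b g ≠ 0 →
      (∃ i j, evalMap H a i * evalMap H b j ≠ evalMap H a j * evalMap H b i) →
      ∃ c ≠ 0, VanishesAlong H (evalMap H a) c ∧ VanishesAlong H (evalMap H b) c := by
  classical
  have hd : 0 < d := degree_pos_of_jacobianRank hH (by omega)
  obtain ⟨s, hs, hsmax⟩ := Finset.exists_max_image
    (Finset.univ.filter fun s : Finset (Fin n) => AlgebraicIndependent ℂ fun i : s => H i)
    Finset.card ⟨∅, by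
      simp only [Finset.mem_filter, Finset.mem_univ, true_and]
      exact algebraicIndependent_empty_type⟩
  simp only [Finset.mem_filter, Finset.mem_univ, true_and] at hs hsmax
  have hmax : ∀ j, ¬ AlgebraicIndependent ℂ fun o : Option s => o.elim (H j) fun i => H i := by
    intro j hj
    by_cases hjs : j ∈ s
    · have := hj.injective (a₁ := none) (a₂ := some ⟨j, hjs⟩) rfl
      simp at this
    · have h1 : AlgebraicIndependent ℂ fun i : (insert j s : Finset (Fin n)) => H i := by
        have h2 : AlgebraicIndepOn ℂ H (insert j (s : Set (Fin n))) := by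
          refine (AlgebraicIndepOn.insert_iff (by simpa using hjs)).2 ⟨hs, ?_⟩
          rw [Set.image_eq_range]
          exact (AlgebraicIndependent.option_iff.1 hj).2
        rw [← Finset.coe_insert] at h2
        exact h2
      have := hsmax _ h1
      rw [Finset.card_insert_of_notMem hjs] at this
      omega
  obtain ⟨g₀, hg₀, hg⟩ := exists_generic_proportional hd H hH s hs hmax
  have hsr := card_le_jacobianRank H s hs
  -- The reference component j₀ is taken from `s` when possible: its own proportionality equation is
  -- trivial, which saves one equation per point.
  obtain ⟨j₀, hj₀, hcard⟩ : ∃ j₀, H j₀ ≠ 0 ∧ (s.erase j₀).card + 1 ≤ jacobianRank H := by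
    rcases s.eq_empty_or_nonempty with rfl | ⟨j, hj⟩
    · obtain ⟨j, hj⟩ := exists_component_ne_zero (H := H) (by omega)
      exact ⟨j, hj, by simp; omega⟩
    · refine ⟨j, hs.ne_zero ⟨j, hj⟩, ?_⟩
      rw [Finset.card_erase_add_one hj]
      exact hsr
  refine ⟨g₀ * H j₀, mul_ne_zero hg₀ hj₀, ?_⟩
  rintro a b ha hb ⟨i₁, i₂, hab⟩
  rw [map_mul, mul_ne_zero_iff] at ha hb
  set rel : (Fin n → ℂ) → (Fin n → ℂ) → Fin n → MvPolynomial (Fin n) ℂ := fun b v i =>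
    aeval (fun k => X k - C (v k)) (H i * C (eval b (H j₀)) - H j₀ * C (eval b (H i))) with hrel
  have hrelj : ∀ b v, rel b v j₀ = 0 := fun b v => by simp [hrel]
  set v := a - b with hv
  have hav : a - v = b := by simp [hv]
  have hreleval : ∀ v i, eval a (rel (a - v) v i) = 0 := by
    intro v i
    simp only [hrel]
    rw [eval_aeval]
    have : (fun k => eval a (X k - C (v k))) = a - v := by funext k; simp
    rw [this]
    simp only [map_sub, map_mul, eval_C]
    ring
  -- The number of equations is at most 2(r - 1) ≤ n - 1; this is where the upper bound on the rank
  -- enters.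
  obtain ⟨P, hP, hSP, haP, hunb⟩ := exists_prime_unbounded
    ((s.erase j₀).image (rel (a - 0) 0) ∪ (s.erase j₀).image (rel (a - v) v)) (by
      refine (Finset.card_union_le _ _).trans_lt ?_
      have h1 := Finset.card_image_le (s := s.erase j₀) (f := rel (a - 0) 0)
      have h2 := Finset.card_image_le (s := s.erase j₀) (f := rel (a - v) v)
      omega) a (by
      intro f hf
      rw [Finset.mem_union, Finset.mem_image, Finset.mem_image] at hf
      obtain ⟨i, -, rfl⟩ | ⟨i, -, rfl⟩ := hf <;> exact hreleval _ _)
  have hmem : ∀ v', v' = 0 ∨ v' = v → ∀ i ∈ s, rel (a - v') v' i ∈ P := by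
    intro v' hv' i hi
    by_cases hij : i = j₀
    · rw [hij, hrelj]; exact P.zero_mem
    · refine hSP _ (Finset.mem_union.2 ?_)
      have := Finset.mem_erase.2 ⟨hij, hi⟩
      rcases hv' with rfl | rfl
      · exact Or.inl (Finset.mem_image_of_mem _ this)
      · exact Or.inr (Finset.mem_image_of_mem _ this)
  have hT : ∀ v', v' = 0 ∨ v' = v → ∀ y ∈ zeroLocus ℂ P,
      y - v' ∈ translationCone H (evalMap H (a - v')) j₀ := by
    intro v' hv' y hy
    refine sub_mem_translationCone hqt hg P hP a v' haP ?_ j₀ ?_ (hmem v' hv') y hy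
    · rcases hv' with rfl | rfl
      · simpa using ha.1
      · rw [hav]; exact hb.1
    · rcases hv' with rfl | rfl
      · simpa using ha.2
      · rw [hav]; exact hb.2
  obtain ⟨c, hc0, hc₁, hc₂⟩ := exists_common_direction v hunb
    (isClosed_translationCone H (evalMap H a) j₀) (isClosed_translationCone H (evalMap H b) j₀)
    (fun z hz e he => smul_mem_translationCone hH hz he)
    (fun z hz e he => smul_mem_translationCone hH hz he)
    (fun y hy => by simpa using hT 0 (Or.inl rfl) y hy)
    (fun y hy => by simpa [hav] using hT v (Or.inr rfl) y hy)
  -- Otherwise H(a) and H(b) would both be multiples of H(c), contradicting the nonzero minor.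
  have hHj : evalMap H c j₀ = 0 := by
    by_contra hne
    have e1 := hc₁.1 i₁
    have e2 := hc₁.1 i₂
    have e3 := hc₂.1 i₁
    have e4 := hc₂.1 i₂
    apply hab
    have hne' : evalMap H c j₀ * evalMap H c j₀ ≠ 0 := mul_ne_zero hne hne
    refine mul_left_cancel₀ hne' ?_
    linear_combination (evalMap H a j₀ * evalMap H c i₂) * e3 -
      (evalMap H a j₀ * evalMap H c i₁) * e4 - (evalMap H b i₂ * evalMap H c j₀) * e1 +
      (evalMap H b i₁ * evalMap H c j₀) * e2
  have hHc : evalMap H c = 0 := by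
    funext j
    have := hc₁.1 j
    rw [hHj, mul_zero, mul_eq_zero] at this
    exact this.resolve_left ha.2
  exact ⟨c, hc0, vanishesAlong_of_add_smul hH fun t => (hc₁.2 t).trans hHc,
    vanishesAlong_of_add_smul hH fun t => (hc₂.2 t).trans hHc⟩

/-! ### Homogeneous equations for vanishing along a line -/

theorem map_homogeneousComponent {σ R S : Type*} [CommSemiring R] [CommSemiring S] (f : R →+* S)
    (e : ℕ) (p : MvPolynomial σ R) :
    map f (homogeneousComponent e p) = homogeneousComponent e (map f p) := by
  ext α
  rw [coeff_map, coeff_homogeneousComponent, coeff_homogeneousComponent, coeff_map]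
  split_ifs <;> simp

/-- The components are the coefficients of t ↦ G(tc). Vanishing on a line thus becomes a system of
homogeneous equations in its direction, as elimination requires. -/
theorem forall_eval_homogeneousComponent_eq_zero_iff {n : ℕ} (G : MvPolynomial (Fin n) ℂ)
    (c : Fin n → ℂ) :
    (∀ e, eval c (homogeneousComponent e G) = 0) ↔ ∀ t : ℂ, eval (t • c) G = 0 := by
  have hG : ∀ t : ℂ, eval (t • c) G =
      ∑ e ∈ Finset.range (G.totalDegree + 1), eval c (homogeneousComponent e G) * t ^ e := by
    intro t
    conv_lhs => rw [← sum_homogeneousComponent G]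
    rw [map_sum]
    refine Finset.sum_congr rfl fun e _ => ?_
    have := aeval_mul_of_isHomogeneous (homogeneousComponent_isHomogeneous e G) t c
    rw [aeval_eq_eval, mul_comm] at this
    exact this
  constructor
  · intro h t
    rw [hG]
    exact Finset.sum_eq_zero fun e _ => by rw [h, zero_mul]
  · intro h e
    set Q : Polynomial ℂ := ∑ e ∈ Finset.range (G.totalDegree + 1),
      Polynomial.C (eval c (homogeneousComponent e G)) * Polynomial.X ^ e with hQ
    have hQ0 : Q = 0 := Polynomial.funext fun t => by
      rw [hQ, Polynomial.eval_finsetSum, Polynomial.eval_zero, ← h t, hG]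
      simp
    by_cases he : e ≤ G.totalDegree
    · have h1 := congrArg (fun q => Polynomial.coeff q e) hQ0
      simpa [hQ, Polynomial.finsetSum_coeff, Polynomial.coeff_C_mul, Polynomial.coeff_X_pow,
        he, Nat.lt_succ_iff] using h1
    · rw [homogeneousComponent_eq_zero _ _ (not_le.1 he), map_zero]

/-- The condition `VanishesAlong H u c`, as homogeneous equations in `c` over a ring containing
the coordinates of `u`. -/
noncomputable def alongPoly {n : ℕ} {R : Type*} [CommRing R] [Algebra ℂ R] (H : PolyMap n)
    (u : Fin n → R) (i : Fin n) (e : ℕ) : MvPolynomial (Fin n) R :=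
  homogeneousComponent e (aeval (fun k => C (u k) + X k) (H i))

theorem vanishesAlong_iff {n : ℕ} {R : Type*} [CommRing R] [Algebra ℂ R] (H : PolyMap n)
    (u : Fin n → R) (φ : R →ₐ[ℂ] ℂ) (c : Fin n → ℂ) :
    (∀ i e, eval c (map (φ : R →+* ℂ) (alongPoly H u i e)) = 0) ↔
      VanishesAlong H (fun k => φ (u k)) c := by
  have h1 : ∀ i, map (φ : R →+* ℂ) (aeval (fun k => C (u k) + X k) (H i)) =
      aeval (fun k => C (φ (u k)) + X k) (H i) := by
    intro i
    change ((mapAlgHom φ).comp (aeval _)) (H i) = _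
    congr 1
    exact MvPolynomial.algHom_ext fun k => by simp
  simp only [alongPoly, map_homogeneousComponent, h1, forall_eval_homogeneousComponent_eq_zero_iff]
  simp only [VanishesAlong, funext_iff, evalMap, eval_aeval]
  rw [forall_comm]
  simp
  rfl

/-- The polynomial form of elimination for the conditions used below. -/
theorem exists_eval_ne_zero_of_no_common_zero {n : ℕ} (H : PolyMap n) {κ ι : Type*}
    (u : κ → Fin n → MvPolynomial (Fin n) ℂ) (l : ι → Fin n → MvPolynomial (Fin n) ℂ)
    (q₀ : Fin n → ℂ)
    (h₀ : ∀ c, (∀ x, VanishesAlong H (fun k => eval q₀ (u x k)) c) →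
      (∀ j, ∑ k, eval q₀ (l j k) * c k = 0) → c = 0) :
    ∃ s : MvPolynomial (Fin n) ℂ, eval q₀ s ≠ 0 ∧ ∀ q c, c ≠ 0 →
      (∀ x, VanishesAlong H (fun k => eval q (u x k)) c) →
      (∀ j, ∑ k, eval q (l j k) * c k = 0) → eval q s = 0 := by
  set F : (κ × Fin n × ℕ) ⊕ ι → MvPolynomial (Fin n) (MvPolynomial (Fin n) ℂ) :=
    Sum.elim (fun x => alongPoly H (u x.1) x.2.1 x.2.2) (fun j => ∑ k, C (l j k) * X k)
  have hF : ∀ x, (F x).IsHomogeneous (Sum.elim (fun x => x.2.2) (fun _ => 1) x) := by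
    rintro (x | j)
    · exact homogeneousComponent_isHomogeneous _ _
    · exact IsHomogeneous.sum _ _ _ fun k _ => isHomogeneous_C_mul_X _ _
  have hiff : ∀ q c, (∀ x, eval c (map (eval q) (F x)) = 0) ↔
      (∀ x, VanishesAlong H (fun k => eval q (u x k)) c) ∧
        ∀ j, ∑ k, eval q (l j k) * c k = 0 := by
    intro q c
    rw [Sum.forall]
    refine and_congr ?_ (forall_congr' fun j => ?_)
    · simp only [Prod.forall, F, Sum.elim_inl]
      exact forall_congr' fun x => by
        have := vanishesAlong_iff H (u x) (aeval q) c
        rw [aeval_eq_eval] at this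
        exact this
    · simp [F]
  obtain ⟨s, hs, hs'⟩ := exists_ne_zero_of_no_nontrivial_zero F _ hF (eval q₀)
    (fun a => ⟨C a, by simp⟩) fun c hc => h₀ c ((hiff _ _).1 hc).1 ((hiff _ _).1 hc).2
  exact ⟨s, hs, fun q c hc h h' => hs' (eval q) c hc ((hiff _ _).2 ⟨h, h'⟩)⟩

/-! ### The closure of the image: density, irreducibility, specialisation -/

theorem eval_aeval_eq_evalMap {n : ℕ} (H : PolyMap n) (a : Fin n → ℂ)
    (f : MvPolynomial (Fin n) ℂ) : eval a (aeval H f) = eval (evalMap H a) f :=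
  eval_aeval a H f

theorem aeval_eq_zero_iff {n : ℕ} (H : PolyMap n) (f : MvPolynomial (Fin n) ℂ) :
    aeval H f = 0 ↔ ∀ a, eval (evalMap H a) f = 0 := by
  constructor
  · intro h a
    rw [← eval_aeval_eq_evalMap, h, map_zero]
  · intro h
    refine MvPolynomial.funext fun a => ?_
    rw [eval_aeval_eq_evalMap, h, map_zero]

/-- The ideal of W is the kernel of f ↦ f(H). It is prime, since the polynomial ring is a domain;
the irreducibility arguments below rest on this. -/
theorem mem_imageClosure_iff {n : ℕ} {H : PolyMap n} {q : Fin n → ℂ} :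
    q ∈ imageClosure H ↔ ∀ f, aeval H f = 0 → eval q f = 0 := by
  simp only [imageClosure, zariskiClosure, mem_zeroLocus_iff, mem_vanishingIdeal_iff,
    Set.forall_mem_range, aeval_eq_zero_iff, aeval_eq_eval]

theorem evalMap_mem_imageClosure {n : ℕ} (H : PolyMap n) (a : Fin n → ℂ) :
    evalMap H a ∈ imageClosure H :=
  mem_imageClosure_iff.2 fun f hf => (aeval_eq_zero_iff H f).1 hf a

theorem exists_mem_imageClosure_ne_zero {n : ℕ} {H : PolyMap n} (hr : 1 ≤ jacobianRank H) :
    ∃ q ∈ imageClosure H, q ≠ 0 := by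
  obtain ⟨j, hj⟩ := exists_component_ne_zero hr
  obtain ⟨b, hb⟩ : ∃ b, eval b (H j) ≠ 0 := by
    by_contra! h
    exact hj (MvPolynomial.funext fun b => by rw [h, map_zero])
  exact ⟨_, evalMap_mem_imageClosure H b, fun h => hb (congrFun h j)⟩

/-- Every polynomial that vanishes on `S` vanishes on the image of `H`. -/
def IsImageDense {n : ℕ} (H : PolyMap n) (S : Set (Fin n → ℂ)) : Prop :=
  ∀ f : MvPolynomial (Fin n) ℂ, (∀ q ∈ S, eval q f = 0) → aeval H f = 0

theorem isImageDense_imageClosure {n : ℕ} (H : PolyMap n) : IsImageDense H (imageClosure H) :=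
  fun f hf => (aeval_eq_zero_iff H f).2 fun a => hf _ (evalMap_mem_imageClosure H a)

theorem isImageDense_of_generic {n : ℕ} {H : PolyMap n} {g : MvPolynomial (Fin n) ℂ} (hg : g ≠ 0) :
    IsImageDense H (evalMap H '' {a | eval a g ≠ 0}) := by
  intro f hf
  refine (mul_eq_zero.1 (MvPolynomial.funext fun a => ?_ : aeval H f * g = 0)).resolve_right hg
  rw [map_mul, map_zero, mul_eq_zero, eval_aeval_eq_evalMap]
  by_cases ha : eval a g = 0
  · exact Or.inr ha
  · exact Or.inl (hf _ ⟨a, ha, rfl⟩)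

theorem IsImageDense.inter_ne_zero {n : ℕ} {H : PolyMap n} {S : Set (Fin n → ℂ)}
    (hS : IsImageDense H S) {s : MvPolynomial (Fin n) ℂ} {p : Fin n → ℂ}
    (hp : p ∈ imageClosure H) (hs : eval p s ≠ 0) : IsImageDense H (S ∩ {q | eval q s ≠ 0}) := by
  intro f hf
  have h1 : aeval H (f * s) = 0 := hS _ fun q hq => by
    rw [map_mul, mul_eq_zero]
    by_cases h : eval q s = 0
    · exact Or.inr h
    · exact Or.inl (hf q ⟨hq, h⟩)
  rw [map_mul, mul_eq_zero] at h1
  exact h1.resolve_right fun h => hs (mem_imageClosure_iff.1 hp s h)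

theorem IsImageDense.mono {n : ℕ} {H : PolyMap n} {S T : Set (Fin n → ℂ)}
    (hS : IsImageDense H S) (h : S ⊆ T) : IsImageDense H T :=
  fun f hf => hS f fun q hq => hf q (h hq)

/-- Irreducibility of the closure of the image. -/
theorem IsImageDense.exists_of_finite_cover {n : ℕ} {H : PolyMap n} {S : Set (Fin n → ℂ)}
    (hS : IsImageDense H S) {T : Type*} [Finite T] (U : T → Set (Fin n → ℂ))
    (hU : ∀ q ∈ S, ∃ t, q ∈ U t) : ∃ t, IsImageDense H (U t) := by
  have := Fintype.ofFinite T
  by_contra! h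
  simp only [IsImageDense] at h
  push Not at h
  choose f hf hf0 using h
  have h1 : aeval H (∏ t, f t) = 0 := hS _ fun q hq => by
    obtain ⟨t, ht⟩ := hU q hq
    rw [map_prod]
    exact Finset.prod_eq_zero (Finset.mem_univ t) (hf t q ht)
  rw [map_prod, Finset.prod_eq_zero_iff] at h1
  obtain ⟨t, -, ht⟩ := h1
  exact hf0 t ht

/-- Solvability of the conditions passes from a dense set to the closure of the image. -/
theorem IsImageDense.exists_common_zero {n : ℕ} {H : PolyMap n} {S : Set (Fin n → ℂ)}
    (hS : IsImageDense H S) {κ ι : Type*}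
    (u : κ → Fin n → MvPolynomial (Fin n) ℂ) (l : ι → Fin n → MvPolynomial (Fin n) ℂ)
    (h : ∀ q ∈ S, ∃ c ≠ 0, (∀ x, VanishesAlong H (fun k => eval q (u x k)) c) ∧
      ∀ j, ∑ k, eval q (l j k) * c k = 0) (q : Fin n → ℂ) (hq : q ∈ imageClosure H) :
    ∃ c ≠ 0, (∀ x, VanishesAlong H (fun k => eval q (u x k)) c) ∧
      ∀ j, ∑ k, eval q (l j k) * c k = 0 := by
  by_contra! hcon
  obtain ⟨s, hs, hs'⟩ := exists_eval_ne_zero_of_no_common_zero H u l q fun c h1 h2 => by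
    by_contra hc
    obtain ⟨j, hj⟩ := hcon c hc h1
    exact hj (h2 j)
  refine hs (mem_imageClosure_iff.1 hq s (hS s fun q' hq' => ?_))
  obtain ⟨c, hc, h1, h2⟩ := h q' hq'
  exact hs' q' c hc h1 h2

/-- One point is specialised at a time: first q, against a fixed generic p = H(a), then p, against
the arbitrary q already reached. -/
theorem exists_common_point {n d : ℕ} {H : PolyMap n}
    (hH : ∀ i, (H i).IsHomogeneous d) (hqt : IsQuasiTranslation (idMap n + H))
    (hr : 2 ≤ jacobianRank H) (hr' : 2 * jacobianRank H ≤ n + 1) {p q : Fin n → ℂ}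
    (hp : p ∈ imageClosure H) (hq : q ∈ imageClosure H) :
    ∃ c ≠ 0, VanishesAlong H p c ∧ VanishesAlong H q c := by
  obtain ⟨g, hg, hgen⟩ := exists_generic_common_point hH hqt hr hr'
  have hclosed : ∀ (S : Set (Fin n → ℂ)) (p : Fin n → ℂ), IsImageDense H S →
      (∀ q ∈ S, ∃ c ≠ 0, VanishesAlong H p c ∧ VanishesAlong H q c) → ∀ q ∈ imageClosure H,
        ∃ c ≠ 0, VanishesAlong H p c ∧ VanishesAlong H q c := by
    intro S p hS h q hq
    obtain ⟨c, hc, h1, -⟩ := hS.exists_common_zero (fun b k => bif b then C (p k) else X k)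
      (fun (j : Empty) => j.elim) (fun q hq => by
        obtain ⟨c, hc, h1, h2⟩ := h q hq
        refine ⟨c, hc, ?_, fun j => j.elim⟩
        rintro (_ | _)
        · simpa using h2
        · simpa using h1) q hq
    exact ⟨c, hc, by simpa using h1 true, by simpa using h1 false⟩
  obtain ⟨j₀, hj₀⟩ := exists_component_ne_zero (H := H) (by omega)
  have hstep : ∀ a, eval a (g * H j₀) ≠ 0 → ∀ q ∈ imageClosure H,
      ∃ c ≠ 0, VanishesAlong H (evalMap H a) c ∧ VanishesAlong H q c := by
    intro a ha
    rw [map_mul, mul_ne_zero_iff] at ha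
    obtain ⟨j, hj⟩ := exists_minor_ne_zero hr (v := evalMap H a) (i := j₀) ha.2
    refine hclosed _ _ (isImageDense_of_generic (mul_ne_zero hg hj)) ?_
    rintro _ ⟨b, hb, rfl⟩
    have hb' : eval b (g * (C (evalMap H a j₀) * H j - C (evalMap H a j) * H j₀)) ≠ 0 := hb
    rw [map_mul, mul_ne_zero_iff] at hb'
    refine hgen a b ha.1 hb'.1 ⟨j₀, j, fun h => hb'.2 ?_⟩
    rw [map_sub, map_mul, map_mul, eval_C, eval_C]
    exact sub_eq_zero.2 h
  obtain ⟨c, hc, h1, h2⟩ := hclosed _ q (isImageDense_of_generic (mul_ne_zero hg hj₀)) (by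
    rintro _ ⟨a, ha, rfl⟩
    obtain ⟨c, hc, h1, h2⟩ := hstep a ha q hq
    exact ⟨c, hc, h2, h1⟩) p hp
  exact ⟨c, hc, h2, h1⟩

/-! ### GN-planes and their intersections -/

theorem finrank_span_pair {n : ℕ} {p c : Fin n → ℂ} (hp : p ≠ 0) (hc : ∀ a : ℂ, a • p ≠ c) :
    Module.finrank ℂ (Submodule.span ℂ {p, c}) = 2 := by
  have := finrank_span_eq_card ((LinearIndependent.pair_iff' hp).2 hc)
  rw [Matrix.range_cons_cons_empty] at this
  simpa using this

theorem isGNPlane_span_pair {n d : ℕ} {H : PolyMap n} (hH : ∀ i, (H i).IsHomogeneous d)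
    {p c : Fin n → ℂ} (hp : p ≠ 0) (hc : ∀ a : ℂ, a • p ≠ c) (h : VanishesAlong H p c) :
    IsGNPlane H (Submodule.span ℂ {p, c}) := by
  refine ⟨finrank_span_pair hp hc, fun x hx => ?_⟩
  obtain ⟨a, b, rfl⟩ := Submodule.mem_span_pair.1 hx
  change evalMap H _ = 0
  by_cases ha : a = 0
  · have h1 := vanishesAlong_of_add_smul hH (p := c) (c := p) h 0
    rw [zero_smul, add_zero] at h1
    rw [ha, zero_smul, zero_add, evalMap_smul hH, h1, smul_zero]
  · have : a • p + b • c = a • (p + (b / a) • c) := by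
      rw [smul_add, smul_smul, mul_div_cancel₀ _ ha]
    rw [this, evalMap_smul hH, h, smul_zero]

theorem IsGNPlane.vanishesAlong {n : ℕ} {H : PolyMap n} {L : Submodule ℂ (Fin n → ℂ)}
    (hL : IsGNPlane H L) {p c : Fin n → ℂ} (hp : p ∈ L) (hc : c ∈ L) : VanishesAlong H p c :=
  fun t => hL.2 (L.add_mem hp (L.smul_mem t hc))

theorem smul_ne_of_apply {n : ℕ} {q c : Fin n → ℂ} {k : Fin n} (hq : q k ≠ 0) (hc : c ≠ 0)
    (hck : c k = 0) (a : ℂ) : a • q ≠ c := by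
  rintro rfl
  have : a = 0 := by simpa [hq] using hck
  exact hc (by simp [this])

theorem eq_span_pair {n : ℕ} {L : Submodule ℂ (Fin n → ℂ)} (hL : Module.finrank ℂ L = 2)
    {q c : Fin n → ℂ} {k : Fin n} (hq : q ∈ L) (hqk : q k ≠ 0) (hc : c ∈ L) (hc0 : c ≠ 0)
    (hck : c k = 0) : L = Submodule.span ℂ {q, c} := by
  symm
  refine Submodule.eq_of_le_of_finrank_eq ?_ ?_
  · rw [Submodule.span_le]
    rintro x (rfl | rfl)
    exacts [hq, hc]
  · rw [hL, finrank_span_pair (fun h => by simp [h] at hqk) (smul_ne_of_apply hqk hc0 hck)]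

/-- When q k ≠ 0, a plane through q meets the hyperplane of vanishing k-th coordinate in a line and
is recovered from it (`eq_span_pair`). Planes through q thus become projective points, to which
elimination applies. -/
theorem exists_mem_apply_eq_zero {n : ℕ} {L : Submodule ℂ (Fin n → ℂ)}
    (hL : Module.finrank ℂ L = 2) {q : Fin n → ℂ} {k : Fin n} (hq : q ∈ L) (hqk : q k ≠ 0) :
    ∃ c ∈ L, c ≠ 0 ∧ c k = 0 := by
  have hlt : Submodule.span ℂ {q} < L := by
    refine lt_of_le_of_ne (by simpa using hq) fun h => ?_
    have := finrank_span_singleton (K := ℂ) (v := q) (fun h => by simp [h] at hqk)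
    rw [h, hL] at this
    omega
  obtain ⟨y, hy, hyq⟩ := SetLike.exists_of_lt hlt
  refine ⟨y - (y k / q k) • q, L.sub_mem hy (L.smul_mem _ hq), fun h => hyq ?_, ?_⟩
  · exact Submodule.mem_span_singleton.2 ⟨y k / q k, (sub_eq_zero.1 h).symm⟩
  · simp [hqk]

/-- Any two points of the closure of the image lie on GN-planes with a common nonzero point. -/
theorem exists_isGNPlane_meet {n d : ℕ} {H : PolyMap n}
    (hH : ∀ i, (H i).IsHomogeneous d) (hqt : IsQuasiTranslation (idMap n + H))
    (hr : 2 ≤ jacobianRank H) (hr' : 2 * jacobianRank H ≤ n + 1) {p q : Fin n → ℂ}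
    (hp : p ∈ imageClosure H) (hq : q ∈ imageClosure H) :
    ∃ Lp Lq : Submodule ℂ (Fin n → ℂ), IsGNPlane H Lp ∧ p ∈ Lp ∧ IsGNPlane H Lq ∧ q ∈ Lq ∧
      ∃ x ≠ 0, x ∈ Lp ∧ x ∈ Lq := by
  have hindep : ∀ p ∈ imageClosure H, ∀ q ∈ imageClosure H, p ≠ 0 → (∀ a : ℂ, a • p ≠ q) →
      ∃ Lp Lq : Submodule ℂ (Fin n → ℂ), IsGNPlane H Lp ∧ p ∈ Lp ∧ IsGNPlane H Lq ∧ q ∈ Lq ∧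
        ∃ x ≠ 0, x ∈ Lp ∧ x ∈ Lq := by
    intro p hp q hq hp0 hpq
    have hq0 : q ≠ 0 := fun h => hpq 0 (by simp [h])
    obtain ⟨c, hc, h1, h2⟩ := exists_common_point hH hqt hr hr' hp hq
    -- If c lies on the line of p or of q, the span of the other point with c contains both p and q,
    -- and serves twice. Both cannot happen, as p and q are independent.
    by_cases hpc : ∀ a : ℂ, a • p ≠ c
    · have hL := isGNPlane_span_pair hH hp0 hpc h1
      have hpL : p ∈ Submodule.span ℂ {p, c} := Submodule.subset_span (by simp)
      have hcL : c ∈ Submodule.span ℂ {p, c} := Submodule.subset_span (by simp)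
      by_cases hqc : ∀ a : ℂ, a • q ≠ c
      · exact ⟨_, _, hL, hpL, isGNPlane_span_pair hH hq0 hqc h2,
          Submodule.subset_span (by simp), c, hc, hcL, Submodule.subset_span (by simp)⟩
      · push Not at hqc
        obtain ⟨a, rfl⟩ := hqc
        have ha : a ≠ 0 := fun h => hc (by simp [h])
        exact ⟨_, _, hL, hpL, hL, ((Submodule.smul_mem_iff _ ha).1 hcL), p, hp0, hpL, hpL⟩
    · push Not at hpc
      obtain ⟨a, rfl⟩ := hpc
      have ha : a ≠ 0 := fun h => hc (by simp [h])
      have hqc : ∀ b : ℂ, b • q ≠ a • p := by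
        intro b hb
        have hb0 : b ≠ 0 := fun h => hc (by rw [← hb, h, zero_smul])
        refine hpq (b⁻¹ * a) ?_
        rw [mul_smul, ← hb, smul_smul, inv_mul_cancel₀ hb0, one_smul]
      have hL := isGNPlane_span_pair hH hq0 hqc h2
      have hpL : p ∈ Submodule.span ℂ {q, a • p} :=
        (Submodule.smul_mem_iff _ ha).1 (Submodule.subset_span (by simp))
      exact ⟨_, _, hL, hpL, hL, Submodule.subset_span (by simp), p, hp0, hpL, hpL⟩
  have hthrough : ∀ p ∈ imageClosure H, p ≠ 0 → ∃ L, IsGNPlane H L ∧ p ∈ L := by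
    intro p hp hp0
    obtain ⟨i, hi⟩ := Function.ne_iff.1 hp0
    obtain ⟨j, hj⟩ := exists_minor_ne_zero hr (v := p) (i := i) hi
    obtain ⟨b, hb⟩ : ∃ b, eval b (C (p i) * H j - C (p j) * H i) ≠ 0 := by
      by_contra! h
      exact hj (MvPolynomial.funext fun b => by rw [h, map_zero])
    obtain ⟨L, _, hL, hpL, -⟩ := hindep p hp _ (evalMap_mem_imageClosure H b) hp0 (by
      intro a ha
      have h1 : ∀ k, a * p k = eval b (H k) := fun k => congrFun ha k
      apply hb
      simp only [map_sub, map_mul, eval_C, ← h1]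
      ring)
    exact ⟨L, hL, hpL⟩
  have hdep : ∀ p ∈ imageClosure H, ∀ q : Fin n → ℂ, p ≠ 0 → (∃ a : ℂ, a • p = q) →
      ∃ L, IsGNPlane H L ∧ p ∈ L ∧ q ∈ L ∧ ∃ x ≠ 0, x ∈ L := by
    rintro p hp _ hp0 ⟨a, rfl⟩
    obtain ⟨L, hL, hpL⟩ := hthrough p hp hp0
    exact ⟨L, hL, hpL, L.smul_mem a hpL, p, hp0, hpL⟩
  by_cases hp0 : p = 0
  · obtain ⟨q', hq', hq0, hqq⟩ : ∃ q' ∈ imageClosure H, q' ≠ 0 ∧ ∃ a : ℂ, a • q' = q := by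
      by_cases hq0 : q = 0
      · obtain ⟨q', hq', hq'0⟩ := exists_mem_imageClosure_ne_zero (H := H) (by omega)
        exact ⟨q', hq', hq'0, 0, by simp [hq0]⟩
      · exact ⟨q, hq, hq0, 1, one_smul _ _⟩
    obtain ⟨L, hL, -, hqL, x, hx, hxL⟩ := hdep q' hq' q hq0 hqq
    exact ⟨L, L, hL, hp0 ▸ L.zero_mem, hL, hqL, x, hx, hxL, hxL⟩
  · by_cases hpq : ∀ a : ℂ, a • p ≠ q
    · exact hindep p hp q hq hp0 hpq
    · push Not at hpq
      obtain ⟨L, hL, hpL, hqL, x, hx, hxL⟩ := hdep p hp q hp0 hpq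
      exact ⟨L, L, hL, hpL, hL, hqL, x, hx, hxL, hxL⟩

theorem sum_mul_apply_single {n : ℕ} (f : Module.Dual ℂ (Fin n → ℂ)) (x : Fin n → ℂ) :
    ∑ i, x i * f (Pi.single i 1) = f x := by
  conv_rhs => rw [← (Pi.basisFun ℂ (Fin n)).sum_repr x, map_sum]
  simp

/-- If GN-planes meeting given subspaces exist through a dense set of points, then they exist
through all points of the closure of the image. -/
theorem IsImageDense.exists_isGNPlane_meet {n d : ℕ} {H : PolyMap n}
    (hH : ∀ i, (H i).IsHomogeneous d) {S : Set (Fin n → ℂ)} (hS : IsImageDense H S)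
    (hne : ∃ q ∈ imageClosure H, q ≠ 0) {κ : Type*} (M : κ → Submodule ℂ (Fin n → ℂ))
    (h : ∀ q ∈ S, ∃ L, IsGNPlane H L ∧ q ∈ L ∧ ∀ i, ∃ x ≠ 0, x ∈ L ∧ x ∈ M i)
    (q : Fin n → ℂ) (hq : q ∈ imageClosure H) :
    ∃ L, IsGNPlane H L ∧ q ∈ L ∧ ∀ i, ∃ x ≠ 0, x ∈ L ∧ x ∈ M i := by
  suffices hnz : ∀ q ∈ imageClosure H, q ≠ 0 →
      ∃ L, IsGNPlane H L ∧ q ∈ L ∧ ∀ i, ∃ x ≠ 0, x ∈ L ∧ x ∈ M i by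
    by_cases hq0 : q = 0
    · obtain ⟨q', hq', hq'0⟩ := hne
      obtain ⟨L, hL, -, hLM⟩ := hnz q' hq' hq'0
      exact ⟨L, hL, hq0 ▸ L.zero_mem, hLM⟩
    · exact hnz q hq hq0
  clear q hq
  intro q hq hq0
  obtain ⟨k, hk⟩ := Function.ne_iff.1 hq0
  have hk' : q k ≠ 0 := hk
  -- The index `none` imposes c k = 0. The others are the minors f(q)f'(c) - f'(q)f(c) for f, f'
  -- annihilating M i; they all vanish exactly when q and c are dependent modulo M i, so that their
  -- span meets M i. They are linear in c and polynomial in q.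
  set l : Option (Σ i : κ, (M i).dualAnnihilator × (M i).dualAnnihilator) → Fin n →
      MvPolynomial (Fin n) ℂ := fun o m => o.elim (C ((Pi.single k 1 : Fin n → ℂ) m)) fun j =>
        (∑ i, X i * C (j.2.1.1 (Pi.single i 1))) * C (j.2.2.1 (Pi.single m 1)) -
        (∑ i, X i * C (j.2.2.1 (Pi.single i 1))) * C (j.2.1.1 (Pi.single m 1)) with hl
  have hl1 : ∀ q c : Fin n → ℂ, ∑ m, eval q (l none m) * c m = c k := by
    intro q c
    simp [hl, Pi.single_apply]
  have hl2 : ∀ (q c : Fin n → ℂ) j, ∑ m, eval q (l (some j) m) * c m =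
      j.2.1.1 q * j.2.2.1 c - j.2.2.1 q * j.2.1.1 c := by
    intro q c j
    simp only [hl, Option.elim, map_sub, map_mul, map_sum, eval_X, eval_C,
      sum_mul_apply_single, sub_mul, Finset.sum_sub_distrib, mul_assoc, ← Finset.mul_sum]
    rw [← sum_mul_apply_single _ c, ← sum_mul_apply_single _ c]
    simp only [mul_comm]
  have hSk := hS.inter_ne_zero (s := X k) hq (by simpa using hk')
  obtain ⟨c, hc, hcv, hcl⟩ := hSk.exists_common_zero (fun (_ : Unit) => X) l (by
      rintro q ⟨hqS, hqk⟩
      have hqk' : q k ≠ 0 := by simpa using hqk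
      obtain ⟨L, hL, hqL, hLM⟩ := h q hqS
      obtain ⟨c, hcL, hc0, hck⟩ := exists_mem_apply_eq_zero hL.1 hqL hqk'
      refine ⟨c, hc0, fun _ => by simpa using hL.vanishesAlong hqL hcL, ?_⟩
      rintro (_ | j)
      · rw [hl1, hck]
      · rw [hl2]
        obtain ⟨x, hx0, hxL, hxM⟩ := hLM j.1
        rw [eq_span_pair hL.1 hqL hqk' hcL hc0 hck] at hxL
        obtain ⟨α, β, rfl⟩ := Submodule.mem_span_pair.1 hxL
        have e1 := (Submodule.mem_dualAnnihilator _).1 j.2.1.2 _ hxM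
        have e2 := (Submodule.mem_dualAnnihilator _).1 j.2.2.2 _ hxM
        simp only [map_add, map_smul, smul_eq_mul] at e1 e2
        by_cases hα : α = 0
        · have hβ : β ≠ 0 := fun h => hx0 (by simp [hα, h])
          refine mul_left_cancel₀ hβ ?_
          linear_combination j.2.1.1 q * e2 - j.2.2.1 q * e1
        · refine mul_left_cancel₀ hα ?_
          linear_combination j.2.2.1 c * e1 - j.2.1.1 c * e2) q hq
  have hck : c k = 0 := by rw [← hl1 q c]; exact hcl none
  have hqc := smul_ne_of_apply hk' hc hck
  refine ⟨Submodule.span ℂ {q, c}, isGNPlane_span_pair hH hq0 hqc (by simpa using hcv ()),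
    Submodule.subset_span (by simp), fun i => ?_⟩
  have hmin : ∀ f ∈ (M i).dualAnnihilator, ∀ f' ∈ (M i).dualAnnihilator,
      f q * f' c - f' q * f c = 0 := fun f hf f' hf' => by
    rw [← hl2 q c ⟨i, ⟨f, hf⟩, ⟨f', hf'⟩⟩]
    exact hcl _
  have hmem : ∀ x, (∀ f ∈ (M i).dualAnnihilator, f x = 0) → x ∈ M i := fun x hx =>
    (Subspace.forall_mem_dualAnnihilator_apply_eq_zero_iff (M i) x).1 hx
  by_cases hall : ∀ f ∈ (M i).dualAnnihilator, f q = 0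
  · exact ⟨q, hq0, Submodule.subset_span (by simp), hmem q hall⟩
  · push Not at hall
    obtain ⟨f, hf, hfq⟩ := hall
    -- This combination is killed by f, and by the minors also by every other f' in the annihilator.
    refine ⟨f c • q - f q • c, fun h0 => ?_, ?_, hmem _ fun f' hf' => ?_⟩
    · refine hqc (f c / f q) ?_
      rw [div_eq_inv_mul, mul_smul, sub_eq_zero.1 h0, smul_smul, inv_mul_cancel₀ hfq, one_smul]
    · exact Submodule.sub_mem _ (Submodule.smul_mem _ _ (Submodule.subset_span (by simp)))
        (Submodule.smul_mem _ _ (Submodule.subset_span (by simp)))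
    · have := hmin f hf f' hf'
      simp only [map_sub, map_smul, smul_eq_mul]
      linear_combination -this

/-! ### Points on finitely many GN-planes -/

theorem isClosed_vanishesAlong {n : ℕ} (H : PolyMap n) (q : Fin n → ℂ) :
    IsClosed {c | VanishesAlong H q c} := by
  simp only [VanishesAlong, Set.ofPred_forall]
  exact isClosed_iInter fun t =>
    isClosed_eq ((continuous_evalMap H).comp (by fun_prop)) continuous_const

theorem VanishesAlong.smul {n : ℕ} {H : PolyMap n} {q c : Fin n → ℂ} (h : VanishesAlong H q c)
    (a : ℂ) : VanishesAlong H q (a • c) := fun t => by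
  rw [smul_smul]
  exact h _

/-- An affine slice of the cone of points along which `H` vanishes is finite, if there is no
nonzero point at infinity. -/
theorem finite_slice {n : ℕ} (H : PolyMap n) (q : Fin n → ℂ) (k : Fin n)
    (f : Module.Dual ℂ (Fin n → ℂ))
    (h : ∀ c, VanishesAlong H q c → c k = 0 → f c = 0 → c = 0) :
    {c | VanishesAlong H q c ∧ c k = 0 ∧ f c = 1}.Finite := by
  set I : Ideal (MvPolynomial (Fin n) ℂ) := Ideal.span
    (Set.range (fun x : Fin n × ℕ => alongPoly H q x.1 x.2) ∪
      {X k, (∑ i, X i * C (f (Pi.single i 1))) - 1})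
  have hI : zeroLocus ℂ I = {c | VanishesAlong H q c ∧ c k = 0 ∧ f c = 1} := by
    ext c
    have h1 := vanishesAlong_iff H q (AlgHom.id ℂ ℂ) c
    have h2 : ((AlgHom.id ℂ ℂ : ℂ →ₐ[ℂ] ℂ) : ℂ →+* ℂ) = RingHom.id ℂ := rfl
    simp only [h2, map_id, AlgHom.coe_id, id_eq] at h1
    rw [zeroLocus_span]
    change _ ↔ VanishesAlong H q c ∧ c k = 0 ∧ f c = 1
    rw [← h1]
    simp [aeval_eq_eval, or_imp, forall_and, sub_eq_zero, sum_mul_apply_single]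
    exact ⟨fun ⟨h1, h2, h3⟩ => ⟨fun i e => h3 _ i e rfl, h1, h2⟩,
      fun ⟨h1, h2, h3⟩ => ⟨h2, h3, fun p i e hp => hp ▸ h1 i e⟩⟩
  rw [← hI]
  by_contra hinf
  obtain ⟨v, hv⟩ := Set.Infinite.nonempty hinf
  rw [hI] at hv
  have hfc : Continuous f := LinearMap.continuous_of_finiteDimensional f
  -- An infinite slice is unbounded. Differences of its points satisfy f = 0, so a limit direction
  -- is a forbidden nonzero solution.
  obtain ⟨c, hc, hc1, hc2⟩ := exists_common_direction
    (T₁ := {c | VanishesAlong H q c ∧ c k = 0}) (T₂ := {c | f c = 0}) v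
    (exists_norm_gt_of_infinite_zeroLocus hinf)
    ((isClosed_vanishesAlong H q).and (isClosed_eq (continuous_apply k) continuous_const))
    (isClosed_eq hfc continuous_const)
    (fun z hz e _ => ⟨hz.1.smul e, by simp [hz.2]⟩)
    (fun z (hz : f z = 0) e _ => by simp [hz])
    (fun y hy => by rw [hI] at hy; exact ⟨hy.1, hy.2.1⟩)
    (fun y hy => by
      rw [hI] at hy
      change f (y - v) = 0
      rw [map_sub, hy.2.2, hv.2.2, sub_self])
  exact hc (h c hc1.1 hc1.2 hc2)

/-- Lying on only finitely many GN-planes is an open condition. -/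
theorem exists_eval_ne_zero_of_finitelyManyGNPlanes {n d : ℕ} {H : PolyMap n}
    (hH : ∀ i, (H i).IsHomogeneous d) {p : Fin n → ℂ} (hp : FinitelyManyGNPlanes H p) :
    ∃ s : MvPolynomial (Fin n) ℂ, eval p s ≠ 0 ∧ ∀ q, eval q s ≠ 0 →
      FinitelyManyGNPlanes H q := by
  by_cases hp0 : p = 0
  · refine ⟨1, by simp, fun q _ => Set.Finite.subset hp ?_⟩
    rintro L ⟨hL, -⟩
    exact ⟨hL, hp0 ▸ L.zero_mem⟩
  obtain ⟨k, hk⟩ := Function.ne_iff.1 hp0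
  have hk' : p k ≠ 0 := hk
  have : Finite {L : Submodule ℂ (Fin n → ℂ) | IsGNPlane H L ∧ p ∈ L} := hp
  choose c hcL hc0 hck using fun L : {L : Submodule ℂ (Fin n → ℂ) | IsGNPlane H L ∧ p ∈ L} =>
    exists_mem_apply_eq_zero L.2.1.1 L.2.2 hk'
  -- A hyperplane f = 0 avoiding the finitely many directions of planes through p. Elimination keeps
  -- it free of such directions for all q with s(q) ≠ 0.
  obtain ⟨f, hf⟩ := Module.exists_dual_forall_apply_ne_zero (K := ℂ) c hc0
  set l : Bool → Fin n → MvPolynomial (Fin n) ℂ := fun b i =>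
    bif b then C ((Pi.single k 1 : Fin n → ℂ) i) else C (f (Pi.single i 1)) with hl
  have hl1 : ∀ q x : Fin n → ℂ, ∑ i, eval q (l true i) * x i = x k := fun q x => by
    simp [hl, Pi.single_apply]
  have hl2 : ∀ q x : Fin n → ℂ, ∑ i, eval q (l false i) * x i = f x := fun q x => by
    simp [hl, ← sum_mul_apply_single f x, mul_comm]
  obtain ⟨s, hs, hs'⟩ := exists_eval_ne_zero_of_no_common_zero H (fun (_ : Unit) => X) l p (by
    intro x hx hxl
    by_contra hx0
    have h1 : x k = 0 := by rw [← hl1 p x]; exact hxl true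
    have h2 : f x = 0 := by rw [← hl2 p x]; exact hxl false
    have hL := isGNPlane_span_pair hH hp0 (smul_ne_of_apply hk' hx0 h1) (by simpa using hx ())
    set L : {L : Submodule ℂ (Fin n → ℂ) | IsGNPlane H L ∧ p ∈ L} :=
      ⟨_, hL, Submodule.subset_span (by simp)⟩ with hLdef
    obtain ⟨α, β, hαβ⟩ := Submodule.mem_span_pair.1 (hcL L)
    have h3 := congrFun hαβ k
    rw [hck L] at h3
    have hα : α = 0 := by simpa [h1, hk'] using h3
    apply hf L
    rw [← hαβ, hα, zero_smul, zero_add, map_smul, h2, smul_zero])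
  refine ⟨s * X k, by simpa [hk'] using hs, fun q hq => ?_⟩
  rw [map_mul, mul_ne_zero_iff, eval_X] at hq
  have hno : ∀ x, VanishesAlong H q x → x k = 0 → f x = 0 → x = 0 := by
    intro x h1 h2 h3
    by_contra hx0
    refine hq.1 (hs' q x hx0 (fun _ => by simpa using h1) ?_)
    rintro (_ | _)
    · rw [hl2, h3]
    · rw [hl1, h2]
  -- Each plane through q has a direction normalised by k-th coordinate 0 and f = 1.
  refine ((finite_slice H q k f hno).image fun x => Submodule.span ℂ {q, x}).subset ?_
  rintro L ⟨hL, hqL⟩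
  obtain ⟨x, hxL, hx0, hxk⟩ := exists_mem_apply_eq_zero hL.1 hqL hq.2
  have hfx : f x ≠ 0 := fun h => hx0 (hno x (hL.vanishesAlong hqL hxL) hxk h)
  have hx'L : (f x)⁻¹ • x ∈ L := L.smul_mem _ hxL
  refine ⟨(f x)⁻¹ • x, ⟨hL.vanishesAlong hqL hx'L, by simp [hxk], by simp [hfx]⟩, ?_⟩
  exact (eq_span_pair hL.1 hqL hq.2 hx'L (by simp [hfx, hx0]) (by simp [hxk])).symm

theorem isImageDense_finitelyManyGNPlanes {n d : ℕ} {H : PolyMap n}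
    (hH : ∀ i, (H i).IsHomogeneous d) {p : Fin n → ℂ} (hpW : p ∈ imageClosure H)
    (hp : FinitelyManyGNPlanes H p) :
    IsImageDense H {q ∈ imageClosure H | FinitelyManyGNPlanes H q} := by
  obtain ⟨s, hs, hs'⟩ := exists_eval_ne_zero_of_finitelyManyGNPlanes hH hp
  exact ((isImageDense_imageClosure H).inter_ne_zero hpW hs).mono fun q hq => ⟨hq.1, hs' q hq.2⟩

theorem IsImageDense.not_subset {n : ℕ} {H : PolyMap n} {S Z : Set (Fin n → ℂ)}
    (hS : IsImageDense H S) (hZ : IsAlgebraicSet Z) (hZW : Z ⊂ imageClosure H) : ¬ S ⊆ Z := by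
  obtain ⟨I, rfl⟩ := hZ
  intro hSZ
  refine hZW.2 fun q hq f hf => ?_
  rw [aeval_eq_eval]
  refine mem_imageClosure_iff.1 hq f (hS f fun q' hq' => ?_)
  have := hSZ hq' f hf
  rwa [aeval_eq_eval] at this

end GN

/-! ### The main theorem -/

theorem mainTheorem3 (n : ℕ) (H : GN.PolyMap n)
    (hhom : GN.IsHomogeneousMap H)
    (hqt : GN.IsQuasiTranslation (GN.idMap n + H))
    (hrk_lower : 2 ≤ GN.jacobianRank H)
    (hrk_upper : (GN.jacobianRank H : ℚ) ≤ ((n : ℚ) + 1) / 2) :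
    (∀ p ∈ GN.imageClosure H, ∀ q ∈ GN.imageClosure H,
      ∃ Lp Lq : Submodule ℂ (Fin n → ℂ),
        GN.IsGNPlane H Lp ∧ p ∈ Lp ∧ GN.IsGNPlane H Lq ∧ q ∈ Lq ∧ Lp ⊓ Lq ≠ ⊥) ∧
    ((∃ p ∈ GN.imageClosure H, GN.FinitelyManyGNPlanes H p) →
      ∀ Z : Set (Fin n → ℂ), GN.IsAlgebraicSet Z → Z ⊂ GN.imageClosure H →
        ¬ {p ∈ GN.imageClosure H | GN.FinitelyManyGNPlanes H p} ⊆ Z) ∧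
    (∀ (k : ℕ) (p : Fin k → Fin n → ℂ),
      (∀ i, p i ∈ GN.imageClosure H) → (∀ i, GN.FinitelyManyGNPlanes H (p i)) →
        ∃ L : Fin k → Submodule ℂ (Fin n → ℂ),
          (∀ i, GN.IsGNPlane H (L i) ∧ p i ∈ L i) ∧
          ∀ q ∈ GN.imageClosure H, ∃ Lq : Submodule ℂ (Fin n → ℂ),
            GN.IsGNPlane H Lq ∧ q ∈ Lq ∧ ∀ i, Lq ⊓ L i ≠ ⊥) := by
  obtain ⟨d, hH⟩ := hhom
  have hr' : 2 * GN.jacobianRank H ≤ n + 1 := by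
    have : (2 * GN.jacobianRank H : ℚ) ≤ n + 1 := by linarith
    exact_mod_cast this
  have hmeet : ∀ L M : Submodule ℂ (Fin n → ℂ), L ⊓ M ≠ ⊥ ↔ ∃ x ≠ 0, x ∈ L ∧ x ∈ M := by
    intro L M
    rw [Submodule.ne_bot_iff]
    exact ⟨fun ⟨x, hx, hx0⟩ => ⟨x, hx0, hx⟩, fun ⟨x, hx0, hx⟩ => ⟨x, hx, hx0⟩⟩
  have hone : ∀ p ∈ GN.imageClosure H, ∀ q ∈ GN.imageClosure H,
      ∃ Lp Lq : Submodule ℂ (Fin n → ℂ),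
        GN.IsGNPlane H Lp ∧ p ∈ Lp ∧ GN.IsGNPlane H Lq ∧ q ∈ Lq ∧ ∃ x ≠ 0, x ∈ Lp ∧ x ∈ Lq :=
    fun p hp q hq => GN.exists_isGNPlane_meet hH hqt hrk_lower hr' hp hq
  have hne : ∃ q ∈ GN.imageClosure H, q ≠ 0 := GN.exists_mem_imageClosure_ne_zero (by omega)
  simp only [hmeet]
  refine ⟨hone, ?_, ?_⟩
  · rintro ⟨p, hpW, hp⟩ Z hZ hZW
    exact (GN.isImageDense_finitelyManyGNPlanes hH hpW hp).not_subset hZ hZW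
  intro k p hpW hp
  -- With k = 0 no point supplies the density of (ii); only a plane through q is needed, and (i)
  -- gives it.
  rcases Nat.eq_zero_or_pos k with rfl | hk
  · refine ⟨fun i => i.elim0, fun i => i.elim0, fun q hq => ?_⟩
    obtain ⟨L, -, hL, hqL, -⟩ := hone q hq q hq
    exact ⟨L, hL, hqL, fun i => i.elim0⟩
  have hdense := GN.isImageDense_finitelyManyGNPlanes hH (hpW ⟨0, hk⟩) (hp ⟨0, hk⟩)
  have hcommon : ∀ q ∈ {q ∈ GN.imageClosure H | GN.FinitelyManyGNPlanes H q},
      ∃ M, GN.IsGNPlane H M ∧ q ∈ M ∧ ∀ p ∈ GN.imageClosure H,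
        ∃ L, GN.IsGNPlane H L ∧ p ∈ L ∧ ∃ x ≠ 0, x ∈ L ∧ x ∈ M := by
    rintro q ⟨hqW, hq⟩
    have : Finite {L : Submodule ℂ (Fin n → ℂ) | GN.IsGNPlane H L ∧ q ∈ L} := hq
    -- Irreducibility lets a single plane M through q serve a dense set of p; specialisation then
    -- gives all p in W.
    obtain ⟨M, hM⟩ := (GN.isImageDense_imageClosure H).exists_of_finite_cover
      (fun M : {L : Submodule ℂ (Fin n → ℂ) | GN.IsGNPlane H L ∧ q ∈ L} =>
        {p | ∃ L, GN.IsGNPlane H L ∧ p ∈ L ∧ ∃ x ≠ 0, x ∈ L ∧ x ∈ M.1}) (by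
        intro p hp
        obtain ⟨L, M, hL, hpL, hM, hqM, hx⟩ := hone p hp q hqW
        exact ⟨⟨M, hM, hqM⟩, L, hL, hpL, hx⟩)
    refine ⟨M.1, M.2.1, M.2.2, fun p hp => ?_⟩
    obtain ⟨L, hL, hpL, hx⟩ := hM.exists_isGNPlane_meet hH hne (fun _ : Unit => M.1) (by
      rintro p ⟨L, hL, hpL, hx⟩
      exact ⟨L, hL, hpL, fun _ => hx⟩) p hp
    exact ⟨L, hL, hpL, hx ()⟩
  have hfin : ∀ i, Finite {L : Submodule ℂ (Fin n → ℂ) | GN.IsGNPlane H L ∧ p i ∈ L} := hp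
  -- The same argument over the finitely many tuples of planes through the points p i.
  obtain ⟨L, hL⟩ := hdense.exists_of_finite_cover
    (fun L : ∀ i, {L : Submodule ℂ (Fin n → ℂ) | GN.IsGNPlane H L ∧ p i ∈ L} =>
      {q | ∃ M, GN.IsGNPlane H M ∧ q ∈ M ∧ ∀ i, ∃ x ≠ 0, x ∈ M ∧ x ∈ (L i).1}) (by
      intro q hq
      obtain ⟨M, hM, hqM, hall⟩ := hcommon q hq
      choose L hL hpL x hx0 hxL hxM using fun i => hall (p i) (hpW i)
      exact ⟨fun i => ⟨L i, hL i, hpL i⟩, M, hM, hqM, fun i => ⟨x i, hx0 i, hxM i, hxL i⟩⟩)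
  exact ⟨fun i => (L i).1, fun i => (L i).2,
    hL.exists_isGNPlane_meet hH hne _ fun q hq => hq⟩
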